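/- \textbf{Setting.} Simple types are built from sorts by $\Rightarrow$; the \emph{type structure} of a type is obtained by identifying all sorts, and the \emph{arity} of $\sigma_1\Rightarrow\dots\Rightarrow\sigma_m\Rightarrow\iota$ ($\iota$ a sort) is $m$. Terms are built from typed variables (countably many of each type) and typed function symbols by well-typed application. Fix an LCSTRS signature: some sorts are \emph{theory sorts} $\iota$, each interpreted by a set $\mathcal X_\iota$ and having exactly one \emph{value} symbol for each element of $\mathcal X_\iota$; one of them is the sort of Booleans; some non-value function symbols of types $\iota_1\Rightarrow\dots\Rightarrow\iota_m\Rightarrow\kappa$ ($m\ge1$, all sorts theory sorts) are \emph{theory symbols}, interpreted by functions; values are theory symbols too. A \emph{theory term} is a term all of whose function symbols are theory symbols (its variables are arbitrary), and $[\![\cdot]\!]$ interprets ground theory terms. The relation $\to_\kappa$ is the closure under contexts of $f\,v_1\cdots v_n\to_\kappa v$, where $f$ is a non-value theory symbol, $v_1,\dots,v_n,v$ are values, $f\,v_1\cdots v_n$ has a sort as type, and $[\![f\,v_1\cdots v_n]\!]=[\![v]\!]$; $s{\downarrow_\kappa}$ is the unique $\to_\kappa$-normal form of $s$. A \emph{constraint}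 is a theory term of Boolean sort whose variables have theory sorts; a substitution $\gamma$ (type-preserving) \emph{respects} $\varphi$ if it maps the variables of $\varphi$ to values and $[\![\varphi\gamma]\!]$ is true. \textbf{Constrained reduction pairs.} A \emph{constrained relation} is a set $R$ of tuples $(s,t,\varphi,L)$, written $s\,R_\varphi^L\,t$, with $s,t$ terms of the same type, $\varphi$ a constraint and $L$ a set of variables. A binary relation $R'$ on terms \emph{covers} $R$ if $s\,R_\varphi^L\,t$ implies $(s\gamma){\downarrow_\kappa}\,R'\,(t\gamma){\downarrow_\kappa}$ for every substitution $\gamma$ that respects $\varphi$ and maps all $x\in L$ to ground theory terms. The pair $(\succeq,\succ)$ is a \emph{constrained reduction pair} if there are a reflexive relation $\sqsupseteq$ covering $\succeq$ and a well-founded relation $\sqsupset$ covering $\succ$ (no infinite $s_0\sqsupset s_1\sqsupset\cdots$) such that ${\to_\kappa}\subseteq{\sqsupseteq}$; ${\sqsupseteq\cdot\sqsupset}\subseteq{\sqsupset^+}$ or ${\sqsupset\cdot\sqsupseteq}\subseteq{\sqsupset^+}$; and $\sqsupseteq$ is monotonic ($s\sqsupseteq t$ implies $C[s]\sqsupseteq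 C[t]$ for every context $C$ such that $C[s]$ and $C[t]$ are well-typed). \textbf{Ingredients.} Given are: a quasi-ordering $\unrhd$ on the non-value symbols, with $\rhd\,={\unrhd}\setminus{\unlhd}$ well-founded, ${\equiv}={\unrhd}\cap{\unlhd}$, and bounded arity in every $\equiv$-class; a filter $\pi$ with $\pi(f)\subseteq\{1,\dots,m\}$ for $f$ of arity $m$, and $\pi(f)=\{1,\dots,m\}$ if $f$ is a theory symbol; for every sort a well-founded (strict) ordering $\blacktriangleright$ and a quasi-ordering $\trianglerighteq$ on its values, such that $v_1\trianglerighteq v_2$ implies $v_1\blacktriangleright v_2$, or $v_1=v_2$, or both are $\blacktriangleright$-minimal. Write $\varphi\Vdash s\blacktriangleright t$ if $(s\gamma){\downarrow_\kappa}\blacktriangleright(t\gamma){\downarrow_\kappa}$ (both being values) for every $\gamma$ that respects $\varphi$ and maps all variables of $s,t$ to ground theory terms; similarly $\varphi\Vdash s\trianglerighteq t$. \textbf{Constrained HORPO.} The following are defined by mutual induction, for fixed $\varphi,L$. $s\succeq_\varphi^L t$, for $s,t$ of the same type structure, if: (Theory) $s,t$ are theory terms of the same sort with all variables in $L$, and $\varphi\Vdash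 s\trianglerighteq t$; or (Eq) $s{\downarrow_\kappa}=t{\downarrow_\kappa}$; or (Mono) $s$ is not a theory term, $s=x\,s_1\cdots s_n$, $t=x\,t_1\cdots t_n$ with $x$ a variable, and $s_i\succeq_\varphi^L t_i$ for all $i$; or (Args) $s$ is not a theory term, $s=f\,s_1\cdots s_n$, $t=g\,t_1\cdots t_n$ with $f\equiv g$ of the same type structure, $\pi(f)=\pi(g)$, and $s_i\succeq_\varphi^L t_i$ for all $i\in\pi(f)\cap\{1,\dots,n\}$; or (Greater) $s\succ_\varphi^L t$. $s\succ_\varphi^L t$, for $s,t$ of the same type structure, if: (Theory) $s,t$ are theory terms of the same sort with all variables in $L$, and $\varphi\Vdash s\blacktriangleright t$; or (Args) as (Args) for $\succeq$, and moreover $s_i\succ_\varphi^L t_i$ for some $i\in\pi(f)\cap\{1,\dots,n\}$; or (Rpo) $s\succ\!\!\succ_\varphi^L t$. $s\succ\!\!\succ_\varphi^L t$, where $s=f\,s_1\cdots s_n$ is not a theory term, $f$ is a function symbol of arity $m$, and $\{n+1,\dots,m\}\subseteq\pi(f)$, if: (Select) $s_i\succeq_\varphi^L t$ for some $i\in\pi(f)\cap\{1,\dots,n\}$;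 or (Appl) $t=t_0\,t_1\cdots t_k$ and $s\succ\!\!\succ_\varphi^L t_i$ for $0\le i\le k$; or (Copy) $t=g\,t_1\cdots t_k$ with $f\rhd g$ and $s\succ\!\!\succ_\varphi^L t_i$ for all $i\in\pi(g)\cap\{1,\dots,k\}$; or (Lex) $t=g\,t_1\cdots t_k$ with $f\equiv g$, and for some $i\in\pi(f)\cap\pi(g)\cap\{1,\dots,\min(n,k)\}$: $\pi(f)\cap\{1,\dots,i\}=\pi(g)\cap\{1,\dots,i\}$; $s_j\succeq_\varphi^L t_j$ for $j\in\pi(f)\cap\{1,\dots,i-1\}$; $s_i\succ_\varphi^L t_i$; and $s\succ\!\!\succ_\varphi^L t_j$ for $j\in\pi(g)\cap\{i+1,\dots,k\}$; or (Th) $t$ is a theory term whose type is a sort, with all variables in $L$. \textbf{Unconstrained HORPO.} Extend $\unrhd$ to all function symbols by: $f\unrhd v$ for non-value $f$ and value $v$ (and never $v\unrhd f$); and $v_1\unrhd v_2$ iff $v_1\blacktriangleright v_2$, or $v_1=v_2$, or both are $\blacktriangleright$-minimal. Put $\pi(v)=\emptyset$ for values; $\rhd$ and $\equiv$ are defined from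 $\unrhd$ as before. $s\approx t$, for $s,t$ of the same type structure, if $s=x\,s_1\cdots s_n$, $t=x\,t_1\cdots t_n$ with $x$ a variable and all $s_i\approx t_i$; or $s=f\,s_1\cdots s_n$, $t=g\,t_1\cdots t_n$ with $f\equiv g$ of the same type structure, $\pi(f)=\pi(g)$, and $s_i\approx t_i$ for all $i\in\pi(f)\cap\{1,\dots,n\}$. $s\sqsupseteq t$ if $s\approx t$ or $s\sqsupset t$. $s\sqsupset t$, for $s,t$ of the same type structure, if: (Gr-mono) $s=x\,s_1\cdots s_n$, $t=x\,t_1\cdots t_n$, all $s_i\sqsupseteq t_i$ and some $s_i\sqsupset t_i$; or (Gr-args) $s=f\,s_1\cdots s_n$, $t=g\,t_1\cdots t_n$ with $f\equiv g$ of the same type structure, $\pi(f)=\pi(g)$, $s_i\sqsupseteq t_i$ for all and $s_i\sqsupset t_i$ for some $i\in\pi(f)\cap\{1,\dots,n\}$; or (Gr-rpo) $s\sqsupset\!\!\sqsupset t$. $s\sqsupset\!\!\sqsupset t$, where $s=f\,s_1\cdots s_n$, $f$ has arity $m$ and $\{n+1,\dots,m\}\subseteq\pi(f)$, if: (Rpo-select)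 $s_i\sqsupseteq t$ for some $i\in\pi(f)\cap\{1,\dots,n\}$; or (Rpo-appl) $t=t_0\,t_1\cdots t_k$ and $s\sqsupset\!\!\sqsupset t_i$ for $0\le i\le k$; or (Rpo-copy) $t=g\,t_1\cdots t_k$ with $f\rhd g$ and $s\sqsupset\!\!\sqsupset t_i$ for all $i\in\pi(g)\cap\{1,\dots,k\}$; or (Rpo-lex) $t=g\,t_1\cdots t_k$ with $f\equiv g$, and for some $i\in\pi(f)\cap\pi(g)\cap\{1,\dots,\min(n,k)\}$: $\pi(f)\cap\{1,\dots,i\}=\pi(g)\cap\{1,\dots,i\}$; $s_j\approx t_j$ for $j\in\pi(f)\cap\{1,\dots,i-1\}$; $s_i\sqsupset t_i$; and $s\sqsupset\!\!\sqsupset t_j$ for $j\in\pi(g)\cap\{i+1,\dots,k\}$. \textbf{Theorem.} The relation $\sqsupseteq$ is reflexive, monotonic, contains $\to_\kappa$ and covers $\succeq$; the relation $\sqsupset$ is well-founded and covers $\succ$; and ${\sqsupseteq\cdot\sqsupset}\subseteq{\sqsupset^+}$ or ${\sqsupset\cdot\sqsupseteq}\subseteq{\sqsupset^+}$. Consequently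 $(\succeq,\succ)$, restricted to pairs of terms of the same type, is a constrained reduction pair, witnessed by $(\sqsupseteq,\sqsupset)$. -/

import Mathlib

universe u v w

namespace LCSTRS

/-! ### Types, signatures and terms -/

/-- Simple types over a set of sorts. -/
inductive Ty (B : Type u) : Type u
  | base (i : B) : Ty B
  | arr (a b : Ty B) : Ty B

namespace Ty

variable {B : Type u}

/-- The type structure of a type: all sorts are identified. -/
def shape : Ty B → Ty Unit
  | base _ => base ()
  | arr a b => arr a.shape b.shape

/-- The number `m` in `σ₁ ⇒ ⋯ ⇒ σₘ ⇒ ι`. -/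
def arity : Ty B → ℕ
  | base _ => 0
  | arr _ b => b.arity + 1

/-- The full function space interpretation of a type. -/
def Interp (X : B → Type w) : Ty B → Type w
  | base i => X i
  | arr a b => Interp X a → Interp X b

/-- Theory types: `ι₁ ⇒ ⋯ ⇒ ιₘ ⇒ κ` where all sorts are theory sorts. -/
inductive IsTheory (T : Set B) : Ty B → Prop
  | base {i : B} : i ∈ T → IsTheory T (base i)
  | arr {i : B} {b : Ty B} : i ∈ T → IsTheory T b → IsTheory T (arr (base i) b)

end Ty

/-- The signature of an LCSTRS. Every theory sort `i` is interpreted by the set `carrier i`, and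
there is exactly one value symbol of sort `i` for every element of `carrier i`; these are added in
`Sym` below, so `Op` consists of the function symbols that are not values. The carriers of sorts
that are not theory sorts are never used. -/
structure Signature where
  Srt : Type u
  Op : Type v
  ty : Op → Ty Srt
  theorySort : Set Srt
  carrier : Srt → Type w
  theoryOp : Set Op
  theoryOp_ty : ∀ f ∈ theoryOp, (ty f).IsTheory theorySort
  /-- Theory symbols whose type is a sort are values, hence not in `Op`. -/
  theoryOp_ne_base : ∀ f ∈ theoryOp, ∀ i, ty f ≠ Ty.base i
  interp : ∀ f ∈ theoryOp, (ty f).Interp carrier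
  boolSort : Srt
  boolSort_mem : boolSort ∈ theorySort
  boolEquiv : carrier boolSort ≃ Bool

variable {S : Signature.{u, v, w}}

/-- Function symbols: values and non-value symbols. -/
inductive Sym (S : Signature.{u, v, w})
  | val (i : S.Srt) (hi : i ∈ S.theorySort) (a : S.carrier i) : Sym S
  | op (f : S.Op) : Sym S

namespace Sym

def ty : Sym S → Ty S.Srt
  | val i _ _ => Ty.base i
  | op f => S.ty f

def IsTheory : Sym S → Prop
  | val _ _ _ => True
  | op f => f ∈ S.theoryOp

end Sym

/-- Variables: countably infinitely many of every type. -/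
structure Var (S : Signature.{u, v, w}) where
  ty : Ty S.Srt
  idx : ℕ

/-- Pre-terms; the terms are the well-typed ones. -/
inductive PTerm (S : Signature.{u, v, w})
  | var (x : Var S) : PTerm S
  | fn (f : Sym S) : PTerm S
  | app (s t : PTerm S) : PTerm S

/-- `HasType s a`: `s` is a term of type `a`. -/
inductive HasType : PTerm S → Ty S.Srt → Prop
  | var (x : Var S) : HasType (.var x) x.ty
  | fn (f : Sym S) : HasType (.fn f) f.ty
  | app {s t : PTerm S} {a b : Ty S.Srt} :
      HasType s (.arr a b) → HasType t a → HasType (.app s t) b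

/-- `HasShape s a`: after collapsing all sorts into one, `s` is well-typed with type `a`. -/
inductive HasShape : PTerm S → Ty Unit → Prop
  | var (x : Var S) : HasShape (.var x) x.ty.shape
  | fn (f : Sym S) : HasShape (.fn f) f.ty.shape
  | app {s t : PTerm S} {a b : Ty Unit} :
      HasShape s (.arr a b) → HasShape t a → HasShape (.app s t) b

/-- `s` and `t` have the same type structure. -/
def SameShape (s t : PTerm S) : Prop := ∃ a, HasShape s a ∧ HasShape t a

/-- Terms: well-typed pre-terms. -/
def Term (S : Signature.{u, v, w}) : Type (max u v w) := {s : PTerm S // ∃ a, HasType s a}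

namespace PTerm

/-- `apps h [s₁, …, sₙ]` is `h s₁ ⋯ sₙ`. -/
def apps (h : PTerm S) (ss : List (PTerm S)) : PTerm S := ss.foldl app h

def vars : PTerm S → Set (Var S)
  | var x => {x}
  | fn _ => ∅
  | app s t => s.vars ∪ t.vars

/-- Theory terms: all function symbols are theory symbols. -/
def IsTheory : PTerm S → Prop
  | var _ => True
  | fn f => f.IsTheory
  | app s t => s.IsTheory ∧ t.IsTheory

/-- Ground theory terms: theory terms without variables. -/
def IsGroundTheory (s : PTerm S) : Prop := s.IsTheory ∧ s.vars = ∅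

def IsValue (s : PTerm S) : Prop := ∃ i hi a, s = fn (.val i hi a)

/-- Application of a map from variables to pre-terms. -/
def subst (γ : Var S → PTerm S) : PTerm S → PTerm S
  | var x => γ x
  | fn f => fn f
  | app s t => app (s.subst γ) (t.subst γ)

end PTerm

/-- Substitutions: type-preserving maps from variables to terms. -/
structure Subst (S : Signature.{u, v, w}) where
  toFun : Var S → PTerm S
  hasType : ∀ x, HasType (toFun x) x.ty

/-! ### Interpretation of ground theory terms, and calculation -/

/-- `Eval s a x`: `s` is a ground theory term of type `a` and `⟦s⟧ = x`. -/
inductive Eval : PTerm S → (a : Ty S.Srt) → a.Interp S.carrier → Prop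
  | val (i : S.Srt) (hi : i ∈ S.theorySort) (x : S.carrier i) :
      Eval (.fn (.val i hi x)) (.base i) x
  | op (f : S.Op) (hf : f ∈ S.theoryOp) : Eval (.fn (.op f)) (S.ty f) (S.interp f hf)
  | app {s t : PTerm S} {a b : Ty S.Srt} {F : a.Interp S.carrier → b.Interp S.carrier}
      {x : a.Interp S.carrier} :
      Eval s (.arr a b) F → Eval t a x → Eval (.app s t) b (F x)

/-- Calculation at the root: `f v₁ ⋯ vₙ → v` where `f` is a theory symbol that is not a value,
`v₁, …, vₙ` are values, `f v₁ ⋯ vₙ` has as type a sort, and `v` is the value with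
`⟦f v₁ ⋯ vₙ⟧ = ⟦v⟧`. -/
def RootStep (s t : PTerm S) : Prop :=
  ∃ f ∈ S.theoryOp, ∃ vs : List (PTerm S), (∀ v ∈ vs, v.IsValue) ∧ s = (PTerm.fn (.op f)).apps vs ∧
    ∃ (i : S.Srt) (hi : i ∈ S.theorySort) (x : S.carrier i),
      Eval s (.base i) x ∧ t = .fn (.val i hi x)

/-- The calculation relation `→_κ`. -/
inductive KStep : PTerm S → PTerm S → Prop
  | root {s t : PTerm S} : RootStep s t → KStep s t
  | left {s s' : PTerm S} (t : PTerm S) : KStep s s' → KStep (.app s t) (.app s' t)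
  | right (s : PTerm S) {t t' : PTerm S} : KStep t t' → KStep (.app s t) (.app s t')

/-- `u` is a normal form of `s` with respect to `→_κ`. -/
def IsKNF (s u : PTerm S) : Prop := Relation.ReflTransGen KStep s u ∧ ∀ w, ¬ KStep u w

open Classical in
noncomputable def contract (s : PTerm S) : PTerm S :=
  if h : ∃ t, RootStep s t then h.choose else s

/-- The normal form `s↓_κ`; see `isKNF_iff`. -/
noncomputable def knf : PTerm S → PTerm S
  | .var x => .var x
  | .fn f => .fn f
  | .app s t => contract (.app (knf s) (knf t))

theorem Eval.unique {s : PTerm S} {a b : Ty S.Srt} {x : a.Interp S.carrier}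
    {y : b.Interp S.carrier} (h : Eval s a x) (h' : Eval s b y) : a = b ∧ HEq x y := by
  induction h generalizing b with
  | val i hi x => cases h'; exact ⟨rfl, HEq.rfl⟩
  | op f hf => cases h'; exact ⟨rfl, HEq.rfl⟩
  | app h1 h2 ih1 ih2 =>
    cases h' with
    | app k1 k2 =>
      obtain ⟨e1, e2⟩ := ih1 k1
      obtain ⟨e3, e4⟩ := ih2 k2
      cases e1
      cases e2
      cases e4
      exact ⟨rfl, HEq.rfl⟩

theorem RootStep.unique {s t t' : PTerm S} (h : RootStep s t) (h' : RootStep s t') : t = t' := by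
  obtain ⟨_, _, _, _, _, i, hi, x, e, rfl⟩ := h
  obtain ⟨_, _, _, _, _, j, hj, y, e', rfl⟩ := h'
  obtain ⟨e1, e2⟩ := e.unique e'
  cases e1
  cases e2
  rfl

theorem apps_concat (h t : PTerm S) (ss : List (PTerm S)) :
    h.apps (ss ++ [t]) = .app (h.apps ss) t := by
  simp [PTerm.apps]

theorem not_rootStep_fn (f : Sym S) (t : PTerm S) : ¬ RootStep (.fn f) t := by
  rintro ⟨g, hg, vs, _, h, i, hi, x, e, _⟩
  rcases List.eq_nil_or_concat vs with rfl | ⟨vs, v, rfl⟩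
  · have e' : Eval (.fn (.op g)) (.base i) x := by
      rw [h] at e
      exact e
    exact S.theoryOp_ne_base g hg i (e'.unique (Eval.op g hg)).1.symm
  · rw [List.concat_eq_append, apps_concat] at h
    cases h

theorem not_kStep_fn (f : Sym S) (t : PTerm S) : ¬ KStep (.fn f) t := by
  intro h
  cases h with
  | root h => exact not_rootStep_fn _ _ h

theorem not_kStep_var (x : Var S) (t : PTerm S) : ¬ KStep (.var x) t := by
  intro h
  cases h with
  | root h =>
    obtain ⟨g, hg, vs, _, h, _⟩ := h
    rcases List.eq_nil_or_concat vs with rfl | ⟨vs, v, rfl⟩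
    · cases h
    · rw [List.concat_eq_append, apps_concat] at h
      cases h

theorem contract_of_rootStep {s t : PTerm S} (h : RootStep s t) : contract s = t := by
  have h' : ∃ t, RootStep s t := ⟨t, h⟩
  rw [contract, dif_pos h']
  exact h'.choose_spec.unique h

theorem contract_of_not {s : PTerm S} (h : ¬ ∃ t, RootStep s t) : contract s = s := by
  rw [contract, dif_neg h]

theorem knf_reach (s : PTerm S) : Relation.ReflTransGen KStep s (knf s) := by
  induction s with
  | var x => exact .refl
  | fn f => exact .refl
  | app s t ihs iht =>
    have h1 : Relation.ReflTransGen KStep (PTerm.app s t) (.app (knf s) t) :=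
      ihs.lift (fun s => PTerm.app s t) (fun _ _ h => .left t h)
    have h2 : Relation.ReflTransGen KStep (PTerm.app (knf s) t) (.app (knf s) (knf t)) :=
      iht.lift (fun t => PTerm.app (knf s) t) (fun _ _ h => .right _ h)
    refine (h1.trans h2).trans ?_
    rw [knf]
    by_cases h : ∃ u, RootStep (PTerm.app (knf s) (knf t)) u
    · obtain ⟨u, hu⟩ := h
      rw [contract_of_rootStep hu]
      exact .single (.root hu)
    · rw [contract_of_not h]

theorem knf_normal (s : PTerm S) : ∀ w, ¬ KStep (knf s) w := by
  induction s with
  | var x => exact not_kStep_var x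
  | fn f => exact not_kStep_fn f
  | app s t ihs iht =>
    intro w
    rw [knf]
    by_cases h : ∃ u, RootStep (PTerm.app (knf s) (knf t)) u
    · obtain ⟨u, hu⟩ := h
      rw [contract_of_rootStep hu]
      obtain ⟨_, _, _, _, _, i, hi, x, _, rfl⟩ := hu
      exact not_kStep_fn _ _
    · rw [contract_of_not h]
      intro k
      cases k with
      | root k => exact h ⟨_, k⟩
      | left _ k => exact ihs _ k
      | right _ k => exact iht _ k

theorem knf_of_normal {s : PTerm S} (h : ∀ w, ¬ KStep s w) : knf s = s := by
  induction s with
  | var x => rfl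
  | fn f => rfl
  | app s t ihs iht =>
    rw [knf, ihs fun w k => h _ (.left t k), iht fun w k => h _ (.right s k)]
    exact contract_of_not fun ⟨w, k⟩ => h _ (.root k)

theorem normal_of_eval_arr (f : S.Op) (vs : List (PTerm S)) (hvs : ∀ v ∈ vs, v.IsValue)
    (a b : Ty S.Srt) (x : (Ty.arr a b).Interp S.carrier)
    (h : Eval ((PTerm.fn (.op f)).apps vs) (.arr a b) x) :
    ∀ w, ¬ KStep ((PTerm.fn (.op f)).apps vs) w := by
  induction vs using List.reverseRecOn generalizing a b x with
  | nil => exact not_kStep_fn _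
  | append_singleton vs v ih =>
    rw [apps_concat] at h ⊢
    intro w k
    have hroot : ∀ u, ¬ RootStep (((PTerm.fn (.op f)).apps vs).app v) u := by
      rintro u ⟨_, _, _, _, _, i, hi, y, e, _⟩
      cases (e.unique h).1
    cases h with
    | app h1 h2 =>
      cases k with
      | root k => exact hroot _ k
      | left _ k => exact ih (fun v hv => hvs v (by simp [hv])) _ _ _ h1 _ k
      | right _ k =>
        obtain ⟨i, hi, y, rfl⟩ := hvs v (by simp)
        exact not_kStep_fn _ _ k

theorem knf_rootStep {s t : PTerm S} (h : RootStep s t) : knf s = t := by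
  have h' := h
  obtain ⟨f, hf, vs, hvs, rfl, i, hi, x, e, rfl⟩ := h
  rcases List.eq_nil_or_concat vs with rfl | ⟨vs, v, rfl⟩
  · exact absurd h' (not_rootStep_fn _ _)
  · rw [List.concat_eq_append] at hvs h' e ⊢
    rw [apps_concat] at h' e ⊢
    cases e with
    | app h1 h2 =>
      obtain ⟨j, hj, y, rfl⟩ := hvs v (by simp)
      rw [knf, knf_of_normal (normal_of_eval_arr f vs (fun v hv => hvs v (by simp [hv])) _ _ _ h1)]
      exact contract_of_rootStep h'

theorem knf_kStep {s t : PTerm S} (h : KStep s t) : knf s = knf t := by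
  induction h with
  | root h =>
    rw [knf_rootStep h]
    obtain ⟨_, _, _, _, _, i, hi, x, _, rfl⟩ := h
    rfl
  | left t h ih => rw [knf, knf, ih]
  | right s h ih => rw [knf, knf, ih]

/-- `knf s` is the unique normal form of `s` with respect to `→_κ`. -/
theorem isKNF_iff (s u : PTerm S) : IsKNF s u ↔ u = knf s := by
  constructor
  · rintro ⟨h, hn⟩
    rw [← knf_of_normal hn]
    clear hn
    induction h with
    | refl => rfl
    | tail _ k ih => rw [← knf_kStep k, ih]
  · rintro rfl
    exact ⟨knf_reach s, knf_normal s⟩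

theorem HasType.unique {s : PTerm S} {a b : Ty S.Srt} (h : HasType s a) (h' : HasType s b) :
    a = b := by
  induction h generalizing b with
  | var x => cases h'; rfl
  | fn f => cases h'; rfl
  | app _ _ ih _ =>
    cases h' with
    | app k _ => cases ih k; rfl

theorem Eval.hasType {s : PTerm S} {a : Ty S.Srt} {x : a.Interp S.carrier} (h : Eval s a x) :
    HasType s a := by
  induction h with
  | val i hi x => exact HasType.fn (.val i hi x)
  | op f hf => exact HasType.fn (.op f)
  | app _ _ ih1 ih2 => exact .app ih1 ih2

theorem HasType.knf {s : PTerm S} {a : Ty S.Srt} (h : HasType s a) : HasType (knf s) a := by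
  induction h with
  | var x => exact .var x
  | fn f => exact .fn f
  | @app s t a b _ _ ih1 ih2 =>
    rw [LCSTRS.knf]
    by_cases hr : ∃ u, RootStep (PTerm.app (LCSTRS.knf s) (LCSTRS.knf t)) u
    · obtain ⟨u, hu⟩ := hr
      rw [contract_of_rootStep hu]
      obtain ⟨_, _, _, _, _, i, hi, x, e, rfl⟩ := hu
      rw [(HasType.app ih1 ih2).unique e.hasType]
      exact HasType.fn (.val i hi x)
    · rw [contract_of_not hr]
      exact .app ih1 ih2

theorem HasType.subst {s : PTerm S} {a : Ty S.Srt} (h : HasType s a) (γ : Subst S) :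
    HasType (s.subst γ.toFun) a := by
  induction h with
  | var x => exact γ.hasType x
  | fn f => exact .fn f
  | app _ _ ih1 ih2 => exact .app ih1 ih2

/-- The term `sγ`. -/
def Term.subst (s : Term S) (γ : Subst S) : Term S :=
  ⟨s.1.subst γ.toFun, s.2.imp fun _ h => h.subst γ⟩

/-- The term `s↓_κ`. -/
noncomputable def Term.knf (s : Term S) : Term S := ⟨LCSTRS.knf s.1, s.2.imp fun _ h => h.knf⟩

/-- `s` and `t` have the same type. -/
def Term.SameType (s t : Term S) : Prop := ∃ a, HasType s.1 a ∧ HasType t.1 a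

/-! ### Constraints and constrained reduction pairs -/

/-- Constraints: theory terms of the sort of Booleans whose variables all have a theory sort. -/
structure Constraint (S : Signature.{u, v, w}) where
  term : PTerm S
  isTheory : term.IsTheory
  hasType : HasType term (.base S.boolSort)
  vars_sort : ∀ x ∈ term.vars, ∃ i ∈ S.theorySort, x.ty = .base i

/-- `γ` respects `φ`: it maps the variables of `φ` to values, and `⟦φγ⟧` is true. -/
def Respects (γ : Subst S) (φ : Constraint S) : Prop :=
  (∀ x ∈ φ.term.vars, (γ.toFun x).IsValue) ∧
    Eval (φ.term.subst γ.toFun) (.base S.boolSort) (S.boolEquiv.symm true)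

/-- Sets of tuples `(s, t, φ, L)`. -/
abbrev CRel (S : Signature.{u, v, w}) : Type (max u v w) :=
  Term S → Term S → Constraint S → Set (Var S) → Prop

/-- `R'` covers `R`. -/
def Covers (R' : Term S → Term S → Prop) (R : CRel S) : Prop :=
  ∀ (s t : Term S) (φ : Constraint S) (L : Set (Var S)), R s t φ L →
    ∀ γ : Subst S, Respects γ φ → (∀ x ∈ L, (γ.toFun x).IsGroundTheory) →
      R' (s.subst γ).knf (t.subst γ).knf

/-- One-hole contexts. -/
inductive Ctx (S : Signature.{u, v, w})
  | hole : Ctx S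
  | left (C : Ctx S) (t : PTerm S) : Ctx S
  | right (s : PTerm S) (C : Ctx S) : Ctx S

def Ctx.plug : Ctx S → PTerm S → PTerm S
  | hole, u => u
  | left C t, u => .app (C.plug u) t
  | right s C, u => .app s (C.plug u)

/-- `R` is closed under all contexts `C` for which both `C[s]` and `C[t]` are terms. -/
def Monotonic (R : Term S → Term S → Prop) : Prop :=
  ∀ s t : Term S, R s t → ∀ (C : Ctx S) (hs : ∃ a, HasType (C.plug s.1) a)
    (ht : ∃ a, HasType (C.plug t.1) a), R ⟨C.plug s.1, hs⟩ ⟨C.plug t.1, ht⟩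

/-- `(ge, gt)` witnesses that `(cge, cgt)` is a constrained reduction pair. -/
structure IsCoveringPair (ge gt : Term S → Term S → Prop) (cge cgt : CRel S) : Prop where
  refl : ∀ s, ge s s
  wf : WellFounded fun t s => gt s t
  covers_ge : Covers ge cge
  covers_gt : Covers gt cgt
  kappa : ∀ s t : Term S, KStep s.1 t.1 → ge s t
  compat : (∀ s t u, ge s t → gt t u → Relation.TransGen gt s u) ∨
    (∀ s t u, gt s t → ge t u → Relation.TransGen gt s u)
  mono : Monotonic ge

/-- `R` is a constrained relation: it relates terms of the same type only. -/
def IsConstrainedRelation (R : CRel S) : Prop := ∀ s t φ L, R s t φ L → s.SameType t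

/-- `(cge, cgt)` is a constrained reduction pair. -/
def IsConstrainedReductionPair (cge cgt : CRel S) : Prop :=
  IsConstrainedRelation cge ∧ IsConstrainedRelation cgt ∧
    ∃ ge gt : Term S → Term S → Prop, IsCoveringPair ge gt cge cgt

/-! ### Unconstrained HORPO

Here `pr` is the relation `⊵` on function symbols and `π` the filter. Argument positions are counted
from `0`, so `i ∈ π f` says that the `(i+1)`-th argument of `f` is regarded. -/

/-- The strict part `⊳` of `⊵`. -/
def Strict {A : Type*} (pr : A → A → Prop) (f g : A) : Prop := pr f g ∧ ¬ pr g f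

/-- The equivalence `≡` of `⊵`. -/
def Equi {A : Type*} (pr : A → A → Prop) (f g : A) : Prop := pr f g ∧ pr g f

/-- The relation `≈`. -/
inductive Approx (pr : Sym S → Sym S → Prop) (π : Sym S → Set ℕ) : PTerm S → PTerm S → Prop
  | mono (x : Var S) (ss ts : List (PTerm S)) :
      SameShape ((PTerm.var x).apps ss) ((PTerm.var x).apps ts) → ss.length = ts.length →
      (∀ (i : ℕ) (h : i < ss.length) (h' : i < ts.length), Approx pr π ss[i] ts[i]) →
      Approx pr π ((PTerm.var x).apps ss) ((PTerm.var x).apps ts)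
  | args (f g : Sym S) (ss ts : List (PTerm S)) :
      SameShape ((PTerm.fn f).apps ss) ((PTerm.fn g).apps ts) → ss.length = ts.length →
      f.ty.shape = g.ty.shape → Equi pr f g → π f = π g →
      (∀ (i : ℕ) (h : i < ss.length) (h' : i < ts.length), i ∈ π f → Approx pr π ss[i] ts[i]) →
      Approx pr π ((PTerm.fn f).apps ss) ((PTerm.fn g).apps ts)

mutual

/-- The relation `⊒`. -/
inductive Ge (pr : Sym S → Sym S → Prop) (π : Sym S → Set ℕ) : PTerm S → PTerm S → Prop
  | approx {s t : PTerm S} : Approx pr π s t → Ge pr π s t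
  | greater {s t : PTerm S} : Gt pr π s t → Ge pr π s t

/-- The relation `⊐`. -/
inductive Gt (pr : Sym S → Sym S → Prop) (π : Sym S → Set ℕ) : PTerm S → PTerm S → Prop
  | mono (x : Var S) (ss ts : List (PTerm S)) :
      SameShape ((PTerm.var x).apps ss) ((PTerm.var x).apps ts) → ss.length = ts.length →
      (∀ (i : ℕ) (h : i < ss.length) (h' : i < ts.length), Ge pr π ss[i] ts[i]) →
      (i : ℕ) → (h : i < ss.length) → (h' : i < ts.length) → Gt pr π ss[i] ts[i] →
      Gt pr π ((PTerm.var x).apps ss) ((PTerm.var x).apps ts)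
  | args (f g : Sym S) (ss ts : List (PTerm S)) :
      SameShape ((PTerm.fn f).apps ss) ((PTerm.fn g).apps ts) → ss.length = ts.length →
      f.ty.shape = g.ty.shape → Equi pr f g → π f = π g →
      (∀ (i : ℕ) (h : i < ss.length) (h' : i < ts.length), i ∈ π f → Ge pr π ss[i] ts[i]) →
      (i : ℕ) → (h : i < ss.length) → (h' : i < ts.length) → i ∈ π f → Gt pr π ss[i] ts[i] →
      Gt pr π ((PTerm.fn f).apps ss) ((PTerm.fn g).apps ts)
  | rpo {s t : PTerm S} : SameShape s t → Rpo pr π s t → Gt pr π s t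

/-- The relation `⊐⊐`. In every clause the left-hand side is some `f s₁ ⋯ sₙ`, and all argument
positions of `f` beyond the first `n` are regarded. -/
inductive Rpo (pr : Sym S → Sym S → Prop) (π : Sym S → Set ℕ) : PTerm S → PTerm S → Prop
  | select (f : Sym S) (ss : List (PTerm S)) (t : PTerm S) :
      (∀ j, ss.length ≤ j → j < f.ty.arity → j ∈ π f) →
      (i : ℕ) → (h : i < ss.length) → i ∈ π f → Ge pr π ss[i] t →
      Rpo pr π ((PTerm.fn f).apps ss) t
  | appl (f : Sym S) (ss : List (PTerm S)) (t₀ : PTerm S) (ts : List (PTerm S)) :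
      (∀ j, ss.length ≤ j → j < f.ty.arity → j ∈ π f) →
      Rpo pr π ((PTerm.fn f).apps ss) t₀ →
      (∀ t ∈ ts, Rpo pr π ((PTerm.fn f).apps ss) t) →
      Rpo pr π ((PTerm.fn f).apps ss) (t₀.apps ts)
  | copy (f g : Sym S) (ss ts : List (PTerm S)) :
      (∀ j, ss.length ≤ j → j < f.ty.arity → j ∈ π f) →
      Strict pr f g →
      (∀ (i : ℕ) (h : i < ts.length), i ∈ π g → Rpo pr π ((PTerm.fn f).apps ss) ts[i]) →
      Rpo pr π ((PTerm.fn f).apps ss) ((PTerm.fn g).apps ts)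
  | lex (f g : Sym S) (ss ts : List (PTerm S)) :
      (∀ j, ss.length ≤ j → j < f.ty.arity → j ∈ π f) →
      Equi pr f g →
      (i : ℕ) → (h : i < ss.length) → (h' : i < ts.length) → i ∈ π f → i ∈ π g →
      (∀ j, j ≤ i → (j ∈ π f ↔ j ∈ π g)) →
      (∀ (j : ℕ) (hj : j < ss.length) (hj' : j < ts.length), j < i → j ∈ π f →
        Approx pr π ss[j] ts[j]) →
      Gt pr π ss[i] ts[i] →
      (∀ (j : ℕ) (hj : j < ts.length), i < j → j ∈ π g →
        Rpo pr π ((PTerm.fn f).apps ss) ts[j]) →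
      Rpo pr π ((PTerm.fn f).apps ss) ((PTerm.fn g).apps ts)

end

/-! ### Constrained HORPO -/

/-- The ingredients of constrained HORPO. -/
structure Ingredients (S : Signature.{u, v, w}) where
  /-- The precedence `⊵` on the non-value symbols. -/
  prec : S.Op → S.Op → Prop
  prec_refl : ∀ f, prec f f
  prec_trans : ∀ f g h, prec f g → prec g h → prec f h
  prec_wf : WellFounded fun g f => Strict prec f g
  arity_bounded : ∀ f, ∃ N, ∀ g, Equi prec f g → (S.ty g).arity ≤ N
  /-- The filter; positions are counted from `0`. -/
  filter : S.Op → Set ℕ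
  filter_lt : ∀ f, ∀ i ∈ filter f, i < (S.ty f).arity
  filter_theory : ∀ f ∈ S.theoryOp, ∀ i < (S.ty f).arity, i ∈ filter f
  /-- The well-founded ordering on the values of a sort. -/
  vgt : ∀ i, S.carrier i → S.carrier i → Prop
  vgt_trans : ∀ i a b c, vgt i a b → vgt i b c → vgt i a c
  vgt_wf : ∀ i, WellFounded fun b a => vgt i a b
  /-- The quasi-ordering on the values of a sort. -/
  vge : ∀ i, S.carrier i → S.carrier i → Prop
  vge_refl : ∀ i a, vge i a a
  vge_trans : ∀ i a b c, vge i a b → vge i b c → vge i a c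
  vge_imp : ∀ i a b, vge i a b → vgt i a b ∨ a = b ∨ ((∀ c, ¬ vgt i a c) ∧ ∀ c, ¬ vgt i b c)

/-- A family of relations on the values of each sort, as a relation on symbols. -/
inductive OnValues (r : ∀ i, S.carrier i → S.carrier i → Prop) : Sym S → Sym S → Prop
  | mk (i : S.Srt) (hi : i ∈ S.theorySort) (a b : S.carrier i) :
      r i a b → OnValues r (.val i hi a) (.val i hi b)

/-- `φ ⊩ s r t`: for every substitution that respects `φ` and maps the variables of `s` and `t` to
ground theory terms, the values of the instances of `s` and `t` are related by `r`. -/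
def Entails (φ : Constraint S) (r : ∀ i, S.carrier i → S.carrier i → Prop) (s t : PTerm S) : Prop :=
  ∀ γ : Subst S, Respects γ φ → (∀ x ∈ s.vars ∪ t.vars, (γ.toFun x).IsGroundTheory) →
    ∃ v₁ v₂ : Sym S, knf (s.subst γ.toFun) = .fn v₁ ∧ knf (t.subst γ.toFun) = .fn v₂ ∧
      OnValues r v₁ v₂

mutual

/-- The relation `≽_φ^L`. -/
inductive CGe (D : Ingredients S) (φ : Constraint S) (L : Set (Var S)) : PTerm S → PTerm S → Prop
  | theory (s t : PTerm S) (i : S.Srt) :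
      s.IsTheory → t.IsTheory → HasType s (.base i) → HasType t (.base i) →
      s.vars ∪ t.vars ⊆ L → Entails φ D.vge s t → CGe D φ L s t
  | eq (s t : PTerm S) : SameShape s t → knf s = knf t → CGe D φ L s t
  | mono (x : Var S) (ss ts : List (PTerm S)) :
      SameShape ((PTerm.var x).apps ss) ((PTerm.var x).apps ts) →
      ¬ ((PTerm.var x).apps ss).IsTheory → ss.length = ts.length →
      (∀ (i : ℕ) (h : i < ss.length) (h' : i < ts.length), CGe D φ L ss[i] ts[i]) →
      CGe D φ L ((PTerm.var x).apps ss) ((PTerm.var x).apps ts)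
  | args (f g : S.Op) (ss ts : List (PTerm S)) :
      SameShape ((PTerm.fn (.op f)).apps ss) ((PTerm.fn (.op g)).apps ts) →
      ¬ ((PTerm.fn (.op f)).apps ss).IsTheory → ss.length = ts.length →
      (S.ty f).shape = (S.ty g).shape → Equi D.prec f g → D.filter f = D.filter g →
      (∀ (i : ℕ) (h : i < ss.length) (h' : i < ts.length), i ∈ D.filter f →
        CGe D φ L ss[i] ts[i]) →
      CGe D φ L ((PTerm.fn (.op f)).apps ss) ((PTerm.fn (.op g)).apps ts)
  | greater {s t : PTerm S} : CGt D φ L s t → CGe D φ L s t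

/-- The relation `≻_φ^L`. -/
inductive CGt (D : Ingredients S) (φ : Constraint S) (L : Set (Var S)) : PTerm S → PTerm S → Prop
  | theory (s t : PTerm S) (i : S.Srt) :
      s.IsTheory → t.IsTheory → HasType s (.base i) → HasType t (.base i) →
      s.vars ∪ t.vars ⊆ L → Entails φ D.vgt s t → CGt D φ L s t
  | args (f g : S.Op) (ss ts : List (PTerm S)) :
      SameShape ((PTerm.fn (.op f)).apps ss) ((PTerm.fn (.op g)).apps ts) →
      ¬ ((PTerm.fn (.op f)).apps ss).IsTheory → ss.length = ts.length →
      (S.ty f).shape = (S.ty g).shape → Equi D.prec f g → D.filter f = D.filter g →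
      (∀ (i : ℕ) (h : i < ss.length) (h' : i < ts.length), i ∈ D.filter f →
        CGe D φ L ss[i] ts[i]) →
      (i : ℕ) → (h : i < ss.length) → (h' : i < ts.length) → i ∈ D.filter f →
      CGt D φ L ss[i] ts[i] →
      CGt D φ L ((PTerm.fn (.op f)).apps ss) ((PTerm.fn (.op g)).apps ts)
  | rpo {s t : PTerm S} : SameShape s t → CRpo D φ L s t → CGt D φ L s t

/-- The relation `≻≻_φ^L`. In every clause the left-hand side is some `f s₁ ⋯ sₙ` that is not a
theory term, and all argument positions of `f` beyond the first `n` are regarded. -/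
inductive CRpo (D : Ingredients S) (φ : Constraint S) (L : Set (Var S)) : PTerm S → PTerm S → Prop
  | select (f : S.Op) (ss : List (PTerm S)) (t : PTerm S) :
      ¬ ((PTerm.fn (.op f)).apps ss).IsTheory →
      (∀ j, ss.length ≤ j → j < (S.ty f).arity → j ∈ D.filter f) →
      (i : ℕ) → (h : i < ss.length) → i ∈ D.filter f → CGe D φ L ss[i] t →
      CRpo D φ L ((PTerm.fn (.op f)).apps ss) t
  | appl (f : S.Op) (ss : List (PTerm S)) (t₀ : PTerm S) (ts : List (PTerm S)) :
      ¬ ((PTerm.fn (.op f)).apps ss).IsTheory →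
      (∀ j, ss.length ≤ j → j < (S.ty f).arity → j ∈ D.filter f) →
      CRpo D φ L ((PTerm.fn (.op f)).apps ss) t₀ →
      (∀ t ∈ ts, CRpo D φ L ((PTerm.fn (.op f)).apps ss) t) →
      CRpo D φ L ((PTerm.fn (.op f)).apps ss) (t₀.apps ts)
  | copy (f g : S.Op) (ss ts : List (PTerm S)) :
      ¬ ((PTerm.fn (.op f)).apps ss).IsTheory →
      (∀ j, ss.length ≤ j → j < (S.ty f).arity → j ∈ D.filter f) →
      Strict D.prec f g →
      (∀ (i : ℕ) (h : i < ts.length), i ∈ D.filter g →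
        CRpo D φ L ((PTerm.fn (.op f)).apps ss) ts[i]) →
      CRpo D φ L ((PTerm.fn (.op f)).apps ss) ((PTerm.fn (.op g)).apps ts)
  | lex (f g : S.Op) (ss ts : List (PTerm S)) :
      ¬ ((PTerm.fn (.op f)).apps ss).IsTheory →
      (∀ j, ss.length ≤ j → j < (S.ty f).arity → j ∈ D.filter f) →
      Equi D.prec f g →
      (i : ℕ) → (h : i < ss.length) → (h' : i < ts.length) →
      i ∈ D.filter f → i ∈ D.filter g →
      (∀ j, j ≤ i → (j ∈ D.filter f ↔ j ∈ D.filter g)) →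
      (∀ (j : ℕ) (hj : j < ss.length) (hj' : j < ts.length), j < i → j ∈ D.filter f →
        CGe D φ L ss[j] ts[j]) →
      CGt D φ L ss[i] ts[i] →
      (∀ (j : ℕ) (hj : j < ts.length), i < j → j ∈ D.filter g →
        CRpo D φ L ((PTerm.fn (.op f)).apps ss) ts[j]) →
      CRpo D φ L ((PTerm.fn (.op f)).apps ss) ((PTerm.fn (.op g)).apps ts)
  | th (f : S.Op) (ss : List (PTerm S)) (t : PTerm S) (i : S.Srt) :
      ¬ ((PTerm.fn (.op f)).apps ss).IsTheory →
      (∀ j, ss.length ≤ j → j < (S.ty f).arity → j ∈ D.filter f) →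
      t.IsTheory → HasType t (.base i) → t.vars ⊆ L →
      CRpo D φ L ((PTerm.fn (.op f)).apps ss) t

end

namespace Ingredients

variable (D : Ingredients S)

/-- `v` is minimal with respect to the ordering on values. -/
def MinimalValue (v : Sym S) : Prop := ∀ v', ¬ OnValues D.vgt v v'

/-- The extension of the precedence to all function symbols. -/
def precExt : Sym S → Sym S → Prop
  | .op f, .op g => D.prec f g
  | .op _, .val _ _ _ => True
  | .val _ _ _, .op _ => False
  | .val i hi a, .val j hj b =>
      OnValues D.vgt (.val i hi a) (.val j hj b) ∨ (Sym.val i hi a : Sym S) = .val j hj b ∨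
        (D.MinimalValue (.val i hi a) ∧ D.MinimalValue (.val j hj b))

/-- The filter on all function symbols; values have no arguments. -/
def filterExt : Sym S → Set ℕ
  | .op f => D.filter f
  | .val _ _ _ => ∅

/-- The relation `⊒` on terms, for the extended precedence. -/
def ge (s t : Term S) : Prop := Ge D.precExt D.filterExt s.1 t.1

/-- The relation `⊐` on terms, for the extended precedence. -/
def gt (s t : Term S) : Prop := Gt D.precExt D.filterExt s.1 t.1

/-- The constrained HORPO relation `≽`, on terms of the same type structure. -/
def cge : CRel S := fun s t φ L => CGe D φ L s.1 t.1

/-- The constrained HORPO relation `≻`, on terms of the same type structure. -/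
def cgt : CRel S := fun s t φ L => CGt D φ L s.1 t.1

end Ingredients

/-- The tuples of `R` whose two terms have the same type. -/
def CRel.onSameType (R : CRel S) : CRel S := fun s t φ L => s.SameType t ∧ R s t φ L

end LCSTRS

-- Two facts carry the theorem: the unconstrained order terminates, and normalised instances of
-- constrained comparisons are unconstrained comparisons.
--
-- Termination is a Tait-style computability argument over type structures rather than types, since
-- every comparison identifies sorts. Terms contain no abstractions, so once every symbol is
-- computable every term is (`HasShape.computable`). For a symbol `f` with computable regarded
-- arguments, `terminates_fn_apps` uses an outer induction on `⊳` and an inner one on the tuple of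
-- ordinal ranks of the regarded arguments, compared lexicographically. Ranks are invariant under
-- `≈`, because `≈ · ⊐ ⊆ ⊐` (`Approx.trans_gt`); bounded arity in each `≡`-class gives tuples of one
-- finite length, on which the lexicographic order is well-founded. Disregarded arguments count as
-- rank zero and may be arbitrary.
--
-- Monotonicity is `Ge.app`. It is why `⊐⊐` asks that all missing argument positions be regarded: an
-- argument supplied later can then always be used by Rpo-select.
--
-- For covering, a left-hand side that is not a theory term keeps its head and arguments under
-- instantiation and normalisation, since calculation at the root would make it a theory term
-- (`inst_apps_of_not_isTheory`). The right-hand side may collapse to a value, but every value lies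
-- below every non-value symbol, so the comparison survives (`rpo_contract`, `inst_args`). Theory
-- clauses become comparisons of values, which the extended precedence decides. The constrained Lex
-- clause is weaker before the decisive position than its unconstrained counterpart; passing to the
-- first strict decrease repairs this (`inst_rpo_lex`).

namespace LCSTRS

variable {S : Signature.{u, v, w}}

/-! ### Heads, arguments and type structures -/

namespace PTerm

def head : PTerm S → PTerm S
  | app s _ => s.head
  | var x => var x
  | fn f => fn f

def args : PTerm S → List (PTerm S)
  | app s t => s.args ++ [t]
  | var _ => []
  | fn _ => []

theorem head_apps (h : PTerm S) (ss : List (PTerm S)) : (h.apps ss).head = h.head := by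
  induction ss generalizing h with
  | nil => rfl
  | cons s ss ih => exact ih (h.app s)

theorem args_apps (h : PTerm S) (ss : List (PTerm S)) : (h.apps ss).args = h.args ++ ss := by
  induction ss generalizing h with
  | nil => simp [apps]
  | cons s ss ih =>
    refine (ih (h.app s)).trans ?_
    simp [args]

theorem apps_append (h : PTerm S) (ss ts : List (PTerm S)) :
    h.apps (ss ++ ts) = (h.apps ss).apps ts := by
  simp [apps]

theorem apps_fn_inj {f g : Sym S} {ss ts : List (PTerm S)}
    (h : (fn f).apps ss = (fn g).apps ts) : f = g ∧ ss = ts := by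
  have h1 := congrArg head h
  have h2 := congrArg args h
  simp only [head_apps, args_apps, head, args, List.nil_append] at h1 h2
  exact ⟨by injection h1, h2⟩

theorem apps_var_inj {x y : Var S} {ss ts : List (PTerm S)}
    (h : (var x).apps ss = (var y).apps ts) : x = y ∧ ss = ts := by
  have h1 := congrArg head h
  have h2 := congrArg args h
  simp only [head_apps, args_apps, head, args, List.nil_append] at h1 h2
  exact ⟨by injection h1, h2⟩

theorem apps_var_ne_fn {x : Var S} {g : Sym S} {ss ts : List (PTerm S)} :
    (var x).apps ss ≠ (fn g).apps ts := by
  intro h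
  have h1 := congrArg head h
  simp only [head_apps, head] at h1
  cases h1

theorem subst_apps (γ : Var S → PTerm S) (h : PTerm S) (ss : List (PTerm S)) :
    (h.apps ss).subst γ = (h.subst γ).apps (ss.map (subst γ)) := by
  induction ss generalizing h with
  | nil => rfl
  | cons s ss ih => exact ih (h.app s)

theorem isTheory_apps {h : PTerm S} {ss : List (PTerm S)} :
    (h.apps ss).IsTheory ↔ h.IsTheory ∧ ∀ s ∈ ss, s.IsTheory := by
  induction ss generalizing h with
  | nil => simp [apps]
  | cons s ss ih =>
    refine (ih (h := h.app s)).trans ?_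
    simp [IsTheory, and_assoc]

end PTerm

theorem Ty.arity_shape {B : Type*} (a : Ty B) : a.shape.arity = a.arity := by
  induction a with
  | base i => rfl
  | arr a b _ ih => simp [Ty.shape, Ty.arity, ih]

theorem HasType.hasShape {s : PTerm S} {a : Ty S.Srt} (h : HasType s a) : HasShape s a.shape := by
  induction h with
  | var x => exact .var x
  | fn f => exact .fn f
  | app _ _ ih1 ih2 => exact .app ih1 ih2

theorem HasShape.unique {s : PTerm S} {a b : Ty Unit} (h : HasShape s a) (h' : HasShape s b) :
    a = b := by
  induction h generalizing b with
  | var x => cases h'; rfl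
  | fn f => cases h'; rfl
  | app _ _ ih _ =>
    cases h' with
    | app k _ => cases ih k; rfl

theorem HasShape.app_inv {s t : PTerm S} {b : Ty Unit} (h : HasShape (.app s t) b) :
    ∃ a, HasShape s (.arr a b) ∧ HasShape t a := by
  cases h with
  | app h1 h2 => exact ⟨_, h1, h2⟩

theorem HasShape.apps_inv {h : PTerm S} {ss : List (PTerm S)} {a : Ty Unit}
    (hs : HasShape (h.apps ss) a) :
    (∃ b, HasShape h b ∧ b.arity = ss.length + a.arity) ∧ ∀ s ∈ ss, ∃ c, HasShape s c := by
  induction ss generalizing h with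
  | nil => exact ⟨⟨a, hs, by simp⟩, by simp⟩
  | cons s ss ih =>
    obtain ⟨⟨b, hb, hlen⟩, hss⟩ := ih (h := h.app s) hs
    obtain ⟨c, h1, h2⟩ := hb.app_inv
    refine ⟨⟨_, h1, by simp [Ty.arity, hlen]; omega⟩, ?_⟩
    intro t ht
    rcases List.mem_cons.1 ht with rfl | ht
    · exact ⟨_, h2⟩
    · exact hss t ht

theorem HasShape.getElem {h : PTerm S} {ss : List (PTerm S)} {a : Ty Unit}
    (hs : HasShape (h.apps ss) a) (i : ℕ) (hi : i < ss.length) : ∃ c, HasShape ss[i] c :=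
  hs.apps_inv.2 _ (List.getElem_mem hi)

/-- Supplied and missing arguments together make up the arity. In particular, at base structure no
argument is missing, so the side condition of `⊐⊐` on missing positions is vacuous. -/
theorem HasShape.fn_arity {f : Sym S} {ss : List (PTerm S)} {a : Ty Unit}
    (hs : HasShape ((PTerm.fn f).apps ss) a) : f.ty.arity = ss.length + a.arity := by
  obtain ⟨⟨b, hb, hlen⟩, _⟩ := hs.apps_inv
  cases hb
  rw [← hlen, Ty.arity_shape]

theorem HasShape.subst {s : PTerm S} {a : Ty Unit} (h : HasShape s a) (γ : Subst S) :
    HasShape (s.subst γ.toFun) a := by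
  induction h with
  | var x => exact (γ.hasType x).hasShape
  | fn f => exact .fn f
  | app _ _ ih1 ih2 => exact .app ih1 ih2

theorem RootStep.hasShape {s t : PTerm S} (h : RootStep s t) :
    HasShape s (.base ()) ∧ HasShape t (.base ()) := by
  obtain ⟨f, hf, vs, hvs, rfl, i, hi, x, e, rfl⟩ := h
  exact ⟨e.hasType.hasShape, .fn (.val i hi x)⟩

theorem HasShape.contract {s : PTerm S} {a : Ty Unit} (h : HasShape s a) :
    HasShape (contract s) a := by
  by_cases hr : ∃ u, RootStep s u
  · obtain ⟨u, hu⟩ := hr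
    rw [contract_of_rootStep hu, h.unique hu.hasShape.1]
    exact hu.hasShape.2
  · rwa [contract_of_not hr]

theorem HasShape.knf {s : PTerm S} {a : Ty Unit} (h : HasShape s a) : HasShape (knf s) a := by
  induction h with
  | var x => exact .var x
  | fn f => exact .fn f
  | app _ _ ih1 ih2 => exact (HasShape.app ih1 ih2).contract

theorem SameShape.symm {s t : PTerm S} (h : SameShape s t) : SameShape t s :=
  let ⟨a, h1, h2⟩ := h
  ⟨a, h2, h1⟩

theorem SameShape.trans {s t r : PTerm S} (h : SameShape s t) (h' : SameShape t r) :
    SameShape s r := by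
  obtain ⟨a, h1, h2⟩ := h
  obtain ⟨b, h3, h4⟩ := h'
  cases h2.unique h3
  exact ⟨a, h1, h4⟩

theorem SameShape.app {s s' t t' : PTerm S} {a : Ty Unit} (hs : SameShape s s')
    (ht : SameShape t t') (h : HasShape (.app s t) a) : SameShape (.app s t) (.app s' t') := by
  obtain ⟨c, h1, h2⟩ := h.app_inv
  obtain ⟨b, k1, k2⟩ := hs
  obtain ⟨d, k3, k4⟩ := ht
  cases h1.unique k1
  cases h2.unique k3
  exact ⟨a, h, .app k2 k4⟩

/-- The clauses of the orders speak of whole argument lists, whereas application adds one argument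
at the end; this passes from one view to the other. -/
theorem forall_getElem_concat {A : Type*} {P : ℕ → A → A → Prop} {ss ts : List A} {s t : A}
    (hlen : ss.length = ts.length)
    (h : ∀ (i : ℕ) (hi : i < ss.length) (hi' : i < ts.length), P i ss[i] ts[i])
    (hl : P ss.length s t) (i : ℕ) (hi : i < (ss ++ [s]).length) (hi' : i < (ts ++ [t]).length) :
    P i (ss ++ [s])[i] (ts ++ [t])[i] := by
  by_cases hlt : i < ss.length
  · rw [List.getElem_append_left hlt, List.getElem_append_left (hlen ▸ hlt)]
    exact h i hlt _
  · have : i = ss.length := by simp at hi; omega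
    subst this
    simpa [hlen] using hl

/-! ### The relations of unconstrained HORPO -/

variable {pr : Sym S → Sym S → Prop} {π : Sym S → Set ℕ}

theorem Approx.sameShape {s t : PTerm S} (h : Approx pr π s t) : SameShape s t := by
  cases h <;> assumption

theorem Gt.sameShape {s t : PTerm S} (h : Gt pr π s t) : SameShape s t := by
  cases h <;> assumption

theorem Ge.sameShape {s t : PTerm S} (h : Ge pr π s t) : SameShape s t := by
  cases h with
  | approx h => exact h.sameShape
  | greater h => exact h.sameShape

theorem Approx.app {s s' t t' : PTerm S} {a : Ty Unit} (hs : Approx pr π s s')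
    (ht : Approx pr π t t') (h : HasShape (.app s t) a) :
    Approx pr π (.app s t) (.app s' t') := by
  have hsh := hs.sameShape.app ht.sameShape h
  cases hs with
  | mono x ss ts h1 h2 h3 =>
    simp only [← apps_concat] at hsh ⊢
    exact .mono x _ _ hsh (by simp [h2])
      (forall_getElem_concat (P := fun _ a b => Approx pr π a b) h2 h3 ht)
  | args f g ss ts h1 h2 h3 h4 h5 h6 =>
    simp only [← apps_concat] at hsh ⊢
    exact .args f g _ _ hsh (by simp [h2]) h3 h4 h5
      (forall_getElem_concat (P := fun i a b => i ∈ π f → Approx pr π a b) h2 h6 fun _ => ht)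

theorem Approx.refl (hpr : ∀ f, pr f f) {s : PTerm S} {a : Ty Unit} (h : HasShape s a) :
    Approx pr π s s := by
  induction h with
  | var x => exact .mono x [] [] ⟨_, .var x, .var x⟩ rfl (by simp)
  | fn f => exact .args f f [] [] ⟨_, .fn f, .fn f⟩ rfl rfl ⟨hpr f, hpr f⟩ rfl (by simp)
  | app h1 h2 ih1 ih2 => exact ih1.app ih2 (.app h1 h2)

theorem Approx.symm {s t : PTerm S} (h : Approx pr π s t) : Approx pr π t s := by
  induction h with
  | mono x ss ts h1 h2 _ ih => exact .mono x _ _ h1.symm h2.symm fun i h h' => ih i h' h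
  | args f g ss ts h1 h2 h3 h4 h5 _ ih =>
    exact .args g f _ _ h1.symm h2.symm h3.symm ⟨h4.2, h4.1⟩ h5.symm
      fun i h h' hi => ih i h' h (h5 ▸ hi)

/-- A relation on function symbols that is good enough to serve as precedence of HORPO. -/
structure IsPrecedence (pr : Sym S → Sym S → Prop) : Prop where
  refl : ∀ f, pr f f
  equi_trans : ∀ f g h, Equi pr f g → Equi pr g h → Equi pr f h
  equi_strict : ∀ f g h, Equi pr f g → Strict pr g h → Strict pr f h
  wf : WellFounded fun g f => Strict pr f g
  arity_bounded : ∀ f, ∃ N, ∀ g, Equi pr f g → g.ty.arity ≤ N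

theorem Approx.trans (hpr : IsPrecedence pr) {s t r : PTerm S} (h : Approx pr π s t)
    (h' : Approx pr π t r) : Approx pr π s r := by
  induction h generalizing r with
  | mono x ss ts h1 h2 h3 ih =>
    generalize ht : (PTerm.var x).apps ts = t at h'
    have hsh := h'.sameShape
    cases h' with
    | mono y ts' us k1 k2 k3 =>
      obtain ⟨rfl, rfl⟩ := PTerm.apps_var_inj ht
      exact .mono x _ _ (h1.trans k1) (h2.trans k2)
        fun i h h' => ih i h (h2 ▸ h) (k3 i (h2 ▸ h) h')
    | args => exact absurd ht PTerm.apps_var_ne_fn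
  | args f g ss ts h1 h2 h3 h4 h5 h6 ih =>
    generalize ht : (PTerm.fn g).apps ts = t at h'
    cases h' with
    | mono => exact absurd ht.symm PTerm.apps_var_ne_fn
    | args g' g'' ts' us k1 k2 k3 k4 k5 k6 =>
      obtain ⟨rfl, rfl⟩ := PTerm.apps_fn_inj ht
      exact .args f _ _ _ (h1.trans k1) (h2.trans k2) (h3.trans k3)
        (hpr.equi_trans _ _ _ h4 k4) (h5.trans k5)
        fun i h h' hi => ih i h (h2 ▸ h) hi (k6 i (h2 ▸ h) h' (h5 ▸ hi))

/-- Adding an argument on the left-hand side of `⊐⊐`. -/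
theorem Rpo.app_left {s t : PTerm S} (h : Rpo pr π s t) (r : PTerm S) :
    Rpo pr π (.app s r) t := by
  induction h using Rpo.rec (motive_1 := fun _ _ _ => True) (motive_2 := fun _ _ _ => True) with
  | approx => trivial
  | greater => trivial
  | mono => trivial
  | args => trivial
  | rpo => trivial
  | select f ss t h1 i h2 h3 h4 =>
    rw [← apps_concat]
    refine .select f _ _ (fun j hj => h1 j (by simp at hj; omega)) i (by simp; omega) h3 ?_
    rwa [List.getElem_append_left h2]
  | appl f ss t₀ ts h1 _ _ ih1 ih2 =>
    rw [← apps_concat] at ih1 ⊢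
    refine .appl f _ _ _ (fun j hj => h1 j (by simp at hj; omega)) ih1 fun t ht => ?_
    rw [apps_concat]
    exact ih2 t ht
  | copy f g ss ts h1 h2 _ ih =>
    rw [← apps_concat] at ih ⊢
    exact .copy f g _ _ (fun j hj => h1 j (by simp at hj; omega)) h2 ih
  | lex f g ss ts h1 h2 i h3 h4 h5 h6 h7 h8 h9 _ _ ih =>
    rw [← apps_concat] at ih ⊢
    refine .lex f g _ _ (fun j hj => h1 j (by simp at hj; omega)) h2 i (by simp; omega) h4 h5 h6 h7
      (fun j hj hj' hji hjf => ?_) ?_ ih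
    · rw [List.getElem_append_left (by omega)]
      exact h8 j _ _ hji hjf
    · rwa [List.getElem_append_left h3]

theorem Rpo.exists_head {s t : PTerm S} (h : Rpo pr π s t) :
    ∃ f ss, s = (PTerm.fn f).apps ss ∧ ∀ j, ss.length ≤ j → j < f.ty.arity → j ∈ π f := by
  cases h <;> exact ⟨_, _, rfl, by assumption⟩

theorem Gt.app_left {s s' t t' : PTerm S} {a : Ty Unit} (hs : Gt pr π s s')
    (ht : Ge pr π t t') (h : HasShape (.app s t) a) : Gt pr π (.app s t) (.app s' t') := by
  have hsh := hs.sameShape.app ht.sameShape h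
  cases hs with
  | mono x ss ts h1 h2 h3 i h4 h5 h6 =>
    simp only [← apps_concat] at hsh ⊢
    refine .mono x _ _ hsh (by simp [h2])
      (forall_getElem_concat (P := fun _ a b => Ge pr π a b) h2 h3 ht) i (by simp; omega)
        (by simp; omega) ?_
    rwa [List.getElem_append_left h4, List.getElem_append_left h5]
  | args f g ss ts h1 h2 h3 h4 h5 h6 i h7 h8 h9 h10 =>
    simp only [← apps_concat] at hsh ⊢
    refine .args f g _ _ hsh (by simp [h2]) h3 h4 h5
      (forall_getElem_concat (P := fun i a b => i ∈ π f → Ge pr π a b) h2 h6 fun _ => ht)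
      i (by simp; omega) (by simp; omega) h9 ?_
    rwa [List.getElem_append_left h7, List.getElem_append_left h8]
  | rpo h1 h2 =>
    refine .rpo hsh ?_
    have h3 := h2.app_left t
    obtain ⟨f, ss, rfl, hf⟩ := h2.exists_head
    rw [← apps_concat] at h h3 ⊢
    have hf' : ∀ j, (ss ++ [t]).length ≤ j → j < f.ty.arity → j ∈ π f :=
      fun j hj => hf j (by simp at hj; omega)
    -- Rpo-appl splits `s' t'`: the part `s'` is handled by adding `t` on the left, and `t'` by
    -- selecting the new last argument. Its position is regarded because it was still missing in
    -- `s`.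
    refine .appl f _ s' [t'] hf' h3 fun r hr => ?_
    rw [List.mem_singleton.1 hr]
    have har := h.fn_arity
    simp only [List.length_append, List.length_singleton] at har
    refine .select f _ _ hf' ss.length (by simp) (hf _ le_rfl (by omega)) ?_
    simpa using ht

theorem Ge.app {s s' t t' : PTerm S} {a : Ty Unit} (hs : Ge pr π s s')
    (ht : Ge pr π t t') (h : HasShape (.app s t) a) : Ge pr π (.app s t) (.app s' t') := by
  have hsh := hs.sameShape.app ht.sameShape h
  cases hs with
  | greater hs => exact .greater (hs.app_left ht h)
  | approx hs =>
    cases ht with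
    | approx ht => exact .approx (hs.app ht h)
    | greater ht =>
      cases hs with
      | mono x ss ts h1 h2 h3 =>
        simp only [← apps_concat] at hsh ⊢
        refine .greater (.mono x _ _ hsh (by simp [h2])
          (forall_getElem_concat (P := fun _ a b => Ge pr π a b) h2
            (fun i h h' => .approx (h3 i h h')) (.greater ht)) ss.length (by simp) (by simp [h2]) ?_)
        simpa [h2] using ht
      | args f g ss ts h1 h2 h3 h4 h5 h6 =>
        simp only [← apps_concat] at hsh ⊢
        -- If the filter drops the new position, the strict decrease there is invisible and only `≈`
        -- remains.
        by_cases hr : ss.length ∈ π f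
        · refine .greater (.args f g _ _ hsh (by simp [h2]) h3 h4 h5
            (forall_getElem_concat (P := fun i a b => i ∈ π f → Ge pr π a b) h2
              (fun i h h' hi => .approx (h6 i h h' hi)) fun _ => .greater ht)
            ss.length (by simp) (by simp [h2]) hr ?_)
          simpa [h2] using ht
        · exact .approx (.args f g _ _ hsh (by simp [h2]) h3 h4 h5
            (forall_getElem_concat (P := fun i a b => i ∈ π f → Approx pr π a b) h2 h6
              fun hi => absurd hi hr))

theorem Ge.apps (h : PTerm S) (hpr : ∀ f, pr f f) {ss ts : List (PTerm S)} {a : Ty Unit}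
    (hs : HasShape (h.apps ss) a) (hlen : ss.length = ts.length)
    (hst : ∀ (i : ℕ) (h : i < ss.length) (h' : i < ts.length), Ge pr π ss[i] ts[i]) :
    Ge pr π (h.apps ss) (h.apps ts) := by
  induction ss using List.reverseRecOn generalizing ts a with
  | nil =>
    obtain rfl : ts = [] := List.length_eq_zero_iff.1 hlen.symm
    exact .approx (.refl hpr hs)
  | append_singleton ss s ih =>
    rcases List.eq_nil_or_concat ts with rfl | ⟨ts, t, rfl⟩
    · simp at hlen
    · rw [List.concat_eq_append] at *
      have hlen' : ss.length = ts.length := by simpa using hlen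
      simp only [apps_concat] at hs ⊢
      obtain ⟨c, h1, h2⟩ := hs.app_inv
      refine Ge.app (ih h1 hlen' fun i h h' => ?_) ?_ hs
      · have := hst i (by simp; omega) (by simp; omega)
        rwa [List.getElem_append_left h, List.getElem_append_left h'] at this
      · have := hst ss.length (by simp) (by simp [hlen'])
        simpa [hlen'] using this

/-- `≈ · ⊐ ⊆ ⊐`. -/
theorem Approx.trans_gt (hpr : IsPrecedence pr) {s t r : PTerm S} (h : Approx pr π s t)
    (h' : Gt pr π t r) : Gt pr π s r := by
  revert s
  induction h' using Gt.rec (motive_1 := fun t r _ => ∀ s, Approx pr π s t → Ge pr π s r)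
    (motive_3 := fun t r _ => ∀ s, Approx pr π s t → Rpo pr π s r) with
  | approx h1 => rename_i s h; exact .approx (h.trans hpr h1)
  | greater _ ih => rename_i s h; exact .greater (ih h)
  | mono x ts us k1 k2 _ i k3 k4 _ ih1 ih2 =>
    intro s h
    generalize ht : (PTerm.var x).apps ts = t at h
    cases h with
    | mono y ss ts' h1 h2 h3 =>
      obtain ⟨rfl, rfl⟩ := PTerm.apps_var_inj ht
      exact .mono x _ _ (h1.trans k1) (h2.trans k2)
        (fun i h h' => ih1 i (h2 ▸ h) h' _ (h3 i h (h2 ▸ h))) i (h2 ▸ k3) k4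
        (ih2 (h3 i (h2 ▸ k3) k3))
    | args => exact absurd ht PTerm.apps_var_ne_fn
  | args g g' ts us k1 k2 k3 k4 k5 _ i k6 k7 k8 _ ih1 ih2 =>
    intro s h
    generalize ht : (PTerm.fn g).apps ts = t at h
    cases h with
    | mono => exact absurd ht.symm PTerm.apps_var_ne_fn
    | args f g'' ss ts' h1 h2 h3 h4 h5 h6 =>
      obtain ⟨rfl, rfl⟩ := PTerm.apps_fn_inj ht
      exact .args f _ _ _ (h1.trans k1) (h2.trans k2) (h3.trans k3)
        (hpr.equi_trans _ _ _ h4 k4) (h5.trans k5)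
        (fun i h h' hi => ih1 i (h2 ▸ h) h' (h5 ▸ hi) _ (h6 i h (h2 ▸ h) hi)) i (h2 ▸ k6) k7
        (h5 ▸ k8) (ih2 (h6 i (h2 ▸ k6) k6 (h5 ▸ k8)))
  | rpo k1 _ ih => exact fun h => .rpo (h.sameShape.trans k1) (ih _ h)
  | select g ts r k1 i k2 k3 _ ih =>
    rename_i s h
    generalize ht : (PTerm.fn g).apps ts = t at h
    cases h with
    | mono => exact absurd ht.symm PTerm.apps_var_ne_fn
    | args f g'' ss ts' h1 h2 h3 h4 h5 h6 =>
      obtain ⟨rfl, rfl⟩ := PTerm.apps_fn_inj ht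
      have har : f.ty.arity = g.ty.arity := by rw [← Ty.arity_shape, h3, Ty.arity_shape]
      exact .select f _ _ (by rwa [h2, h5, har]) i (h2 ▸ k2) (h5 ▸ k3)
        (ih _ (h6 i (h2 ▸ k2) k2 (h5 ▸ k3)))
  | appl g ts t₀ us k1 _ _ ih1 ih2 =>
    rename_i s h
    have ih1 := ih1 s h
    have ih2 := fun t ht => ih2 t ht s h
    obtain ⟨f, ss, rfl, hf⟩ := ih1.exists_head
    exact .appl f _ _ _ hf ih1 ih2
  | copy g g' ts us k1 k2 _ ih =>
    rename_i s h
    have ih := fun i hi hi' => ih i hi hi' s h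
    generalize ht : (PTerm.fn g).apps ts = t at h
    cases h with
    | mono => exact absurd ht.symm PTerm.apps_var_ne_fn
    | args f g'' ss ts' h1 h2 h3 h4 h5 h6 =>
      obtain ⟨rfl, rfl⟩ := PTerm.apps_fn_inj ht
      have har : f.ty.arity = g.ty.arity := by rw [← Ty.arity_shape, h3, Ty.arity_shape]
      exact .copy f _ _ _ (by rwa [h2, h5, har]) (hpr.equi_strict _ _ _ h4 k2) ih
  | lex g g' ts us k1 k2 i k3 k4 k5 k6 k7 k8 _ _ ih1 ih2 =>
    rename_i s h
    have ih2 := fun j hj hj' hj'' => ih2 j hj hj' hj'' s h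
    generalize ht : (PTerm.fn g).apps ts = t at h
    cases h with
    | mono => exact absurd ht.symm PTerm.apps_var_ne_fn
    | args f g'' ss ts' h1 h2 h3 h4 h5 h6 =>
      obtain ⟨rfl, rfl⟩ := PTerm.apps_fn_inj ht
      have har : f.ty.arity = g.ty.arity := by rw [← Ty.arity_shape, h3, Ty.arity_shape]
      exact .lex f _ _ _ (by rwa [h2, h5, har]) (hpr.equi_trans _ _ _ h4 k2) i (h2 ▸ k3) k4
        (h5 ▸ k5) k6 (h5 ▸ k7)
        (fun j hj hj' hji hjf => (h6 j hj (h2 ▸ hj) hjf).trans hpr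
          (k8 j (h2 ▸ hj) hj' hji (h5 ▸ hjf)))
        (ih1 (h6 i (h2 ▸ k3) k3 (h5 ▸ k5))) ih2

/-! ### Well-foundedness of unconstrained HORPO -/

/-- There is no infinite `⊐`-sequence from `s`. -/
abbrev Terminates (pr : Sym S → Sym S → Prop) (π : Sym S → Set ℕ) (s : PTerm S) : Prop :=
  Acc (fun t s => Gt pr π s t) s

theorem Terminates.of_ge (hpr : IsPrecedence pr) {s t : PTerm S} (hs : Terminates pr π s)
    (h : Ge pr π s t) : Terminates pr π t := by
  cases h with
  | greater h => exact hs.inv h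
  | approx h => exact ⟨_, fun r hr => hs.inv (h.trans_gt hpr hr)⟩

open Classical in
/-- The ordinal height of a terminating term with respect to `⊐`. -/
noncomputable def rank (pr : Sym S → Sym S → Prop) (π : Sym S → Set ℕ) (s : PTerm S) :
    Ordinal.{max u v w} :=
  if h : Terminates pr π s then h.rank else 0

theorem rank_lt {s t : PTerm S} (hs : Terminates pr π s) (h : Gt pr π s t) :
    rank pr π t < rank pr π s := by
  rw [rank, rank, dif_pos hs, dif_pos (hs.inv h)]
  exact hs.rank_lt_of_rel h

/-- Every `⊐`-reduct of `t` is also one of `s`, so the supremum defining the rank of `t` is bounded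
by the rank of `s`. Symmetry of `≈` then yields equality. -/
theorem rank_le_of_approx (hpr : IsPrecedence pr) {s t : PTerm S} (h : Approx pr π s t) :
    rank pr π t ≤ rank pr π s := by
  by_cases hs : Terminates pr π s
  · have ht := hs.of_ge hpr (.approx h)
    rw [rank, rank, dif_pos hs, dif_pos ht, ht.rank_eq]
    refine Ordinal.iSup_le fun r => Order.succ_le_of_lt ?_
    exact hs.rank_lt_of_rel (h.trans_gt hpr r.2)
  · have ht : ¬ Terminates pr π t := fun ht => hs (ht.of_ge hpr (.approx h.symm))
    rw [rank, rank, dif_neg hs, dif_neg ht]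

theorem rank_eq_of_approx (hpr : IsPrecedence pr) {s t : PTerm S} (h : Approx pr π s t) :
    rank pr π t = rank pr π s :=
  le_antisymm (rank_le_of_approx hpr h) (rank_le_of_approx hpr h.symm)

open Classical in
/-- The ranks of the first `N` arguments, where disregarded arguments do not count. -/
noncomputable def argRanks (pr : Sym S → Sym S → Prop) (π : Sym S → Set ℕ) (N : ℕ) (A : Set ℕ)
    (ss : List (PTerm S)) : Fin N → Ordinal.{max u v w} :=
  fun i => if h : i.1 < ss.length ∧ i.1 ∈ A then rank pr π (ss[i.1]'h.1) else 0

/-- Before position `i` the tuples agree: regarded entries have equal rank by `≈`, disregarded ones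
count zero on both sides. At `i` the rank drops, and what follows is irrelevant to the lexicographic
order. -/
theorem argRanks_lt (hpr : IsPrecedence pr) {N : ℕ} {A B : Set ℕ} {ss ts : List (PTerm S)} (i : ℕ)
    (hN : i < N) (h : i < ss.length) (h' : i < ts.length) (hA : i ∈ A) (hB : i ∈ B)
    (hAB : ∀ j, j ≤ i → (j ∈ A ↔ j ∈ B))
    (heq : ∀ (j : ℕ) (hj : j < ss.length) (hj' : j < ts.length), j < i → j ∈ A →
      Approx pr π ss[j] ts[j])
    (hgt : Gt pr π ss[i] ts[i]) (hs : Terminates pr π ss[i]) :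
    Pi.Lex (· < ·) (· < ·) (argRanks pr π N B ts) (argRanks pr π N A ss) := by
  refine ⟨⟨i, hN⟩, fun j hj => ?_, ?_⟩
  · have hj : j.1 < i := hj
    simp only [argRanks]
    by_cases hjA : j.1 ∈ A
    · rw [dif_pos ⟨hj.trans h', (hAB _ hj.le).1 hjA⟩, dif_pos ⟨hj.trans h, hjA⟩]
      exact rank_eq_of_approx hpr (heq _ _ _ hj hjA)
    · rw [dif_neg fun k => hjA ((hAB _ hj.le).2 k.2), dif_neg fun k => hjA k.2]
  · simp only [argRanks]
    rw [dif_pos ⟨h', hB⟩, dif_pos ⟨h, hA⟩]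
    exact rank_lt hs hgt

/-- The fixed finite length `N` is essential: lexicographic comparison of tuples of unbounded length
is not well-founded. This is where bounded arity enters. -/
theorem argRanks_induction {N : ℕ} {P : (Fin N → Ordinal.{w}) → Prop}
    (h : ∀ m, (∀ m', Pi.Lex (· < ·) (· < ·) m' m → P m') → P m) (m : Fin N → Ordinal.{w}) : P m :=
  (Pi.Lex.wellFounded (· < ·) fun _ => Ordinal.lt_wf).induction m h

/-- In a sequence of weak decreases, one of which is strict, there is a first strict one. -/
theorem exists_first_gt {A : Set ℕ} {ss ts : List (PTerm S)}
    (hge : ∀ (i : ℕ) (h : i < ss.length) (h' : i < ts.length), i ∈ A → Ge pr π ss[i] ts[i])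
    (i : ℕ) (h : i < ss.length) (h' : i < ts.length) (hi : i ∈ A) (hgt : Gt pr π ss[i] ts[i]) :
    ∃ (k : ℕ) (h : k < ss.length) (h' : k < ts.length), k ≤ i ∧ k ∈ A ∧ Gt pr π ss[k] ts[k] ∧
      ∀ (j : ℕ) (hj : j < ss.length) (hj' : j < ts.length), j < k → j ∈ A →
        Approx pr π ss[j] ts[j] := by
  classical
  have hex : ∃ k, ∃ (h : k < ss.length) (h' : k < ts.length), k ∈ A ∧ Gt pr π ss[k] ts[k] :=
    ⟨i, h, h', hi, hgt⟩
  obtain ⟨k1, k2, k3, k4⟩ := Nat.find_spec hex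
  refine ⟨Nat.find hex, k1, k2, Nat.find_min' hex ⟨h, h', hi, hgt⟩, k3, k4,
    fun j hj hj' hlt hjA => ?_⟩
  rcases hge j hj hj' hjA with k | k
  · exact k
  · exact absurd ⟨hj, hj', hjA, k⟩ (Nat.find_min hex hlt)

/-- Only Gr-mono applies to a term headed by a variable, and it lowers the rank tuple of the
arguments lexicographically at the first strict decrease. There is no filter here, so all positions
count. -/
theorem terminates_var_apps (hpr : IsPrecedence pr) (x : Var S) (ss : List (PTerm S))
    (hss : ∀ s ∈ ss, Terminates pr π s) : Terminates pr π ((PTerm.var x).apps ss) := by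
  obtain ⟨N, hN⟩ : ∃ N, N = ss.length := ⟨_, rfl⟩
  obtain ⟨m, hm⟩ : ∃ m, m = argRanks pr π N Set.univ ss := ⟨_, rfl⟩
  induction m using argRanks_induction generalizing ss with
  | h m ih =>
  subst hm
  refine ⟨_, fun t ht => ?_⟩
  generalize hs : (PTerm.var x).apps ss = s at ht
  cases ht with
  | args => exact absurd hs PTerm.apps_var_ne_fn
  | rpo _ h =>
    obtain ⟨f, _, rfl, _⟩ := h.exists_head
    exact absurd hs PTerm.apps_var_ne_fn
  | mono y ss' ts h1 h2 h3 i h4 h5 h6 =>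
    obtain ⟨rfl, rfl⟩ := PTerm.apps_var_inj hs
    obtain ⟨k, k1, k2, _, _, k3, k4⟩ := exists_first_gt (A := Set.univ)
      (fun i h h' _ => h3 i h h') i h4 h5 trivial h6
    refine ih _ (argRanks_lt hpr (A := Set.univ) (B := Set.univ) k (hN ▸ k1) k1 k2 trivial trivial (fun _ _ => Iff.rfl) k4 k3
      (hss _ (List.getElem_mem _))) ts (fun t ht => ?_) (hN.trans h2) rfl
    obtain ⟨j, hj, rfl⟩ := List.getElem_of_mem ht
    exact (hss _ (List.getElem_mem _)).of_ge hpr (h3 j (h2 ▸ hj) hj)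

/-- Computability of terms, by recursion on the type structure. -/
def Computable (pr : Sym S → Sym S → Prop) (π : Sym S → Set ℕ) : Ty Unit → PTerm S → Prop
  | .base i, s => HasShape s (.base i) ∧ Terminates pr π s
  | .arr a b, s => HasShape s (.arr a b) ∧
      ∀ t, Computable pr π a t → Computable pr π b (.app s t)

theorem Computable.hasShape {a : Ty Unit} {s : PTerm S} (h : Computable pr π a s) :
    HasShape s a := by
  cases a <;> exact h.1

/-- At arrow structure, monotonicity turns `s ⊒ t` into `s r ⊒ t r`, which is the induction
hypothesis at a smaller structure. -/
theorem Computable.of_ge (hpr : IsPrecedence pr) {a : Ty Unit} {s t : PTerm S}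
    (hs : Computable pr π a s) (h : Ge pr π s t) : Computable pr π a t := by
  induction a generalizing s t with
  | base i =>
    obtain ⟨b, h1, h2⟩ := h.sameShape
    cases h1.unique hs.1
    exact ⟨h2, hs.2.of_ge hpr h⟩
  | arr a b _ ih =>
    obtain ⟨b, h1, h2⟩ := h.sameShape
    cases h1.unique hs.1
    exact ⟨h2, fun r hr => ih (hs.2 r hr)
      (h.app (.approx (.refl hpr.refl hr.hasShape)) (.app h1 hr.hasShape))⟩

/-- Guarantees a variable of every type structure, needed to apply a computable term of arrow
structure to something. -/
theorem exists_shape_eq (S : Signature.{u, v, w}) (a : Ty Unit) : ∃ b : Ty S.Srt, b.shape = a := by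
  induction a with
  | base i => exact ⟨.base S.boolSort, rfl⟩
  | arr a b iha ihb =>
    obtain ⟨a, rfl⟩ := iha
    obtain ⟨b, rfl⟩ := ihb
    exact ⟨.arr a b, rfl⟩

/-- A descending sequence from `s` becomes one from `s t` by applying every member to `t`. -/
theorem Terminates.of_app (hpr : IsPrecedence pr) {s t : PTerm S} {a : Ty Unit}
    (hs : HasShape (.app s t) a) (h : Terminates pr π (.app s t)) : Terminates pr π s := by
  generalize hr : PTerm.app s t = r at h
  induction h generalizing s with
  | intro r _ ih =>
  subst hr
  refine ⟨_, fun s' hs' => ?_⟩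
  obtain ⟨c, h1, h2⟩ := hs.app_inv
  have hgt := hs'.app_left (.approx (.refl hpr.refl h2)) hs
  obtain ⟨b, h3, h4⟩ := hgt.sameShape
  cases h3.unique hs
  exact ih _ hgt h4 rfl

/-- The two claims need each other. Termination at `a ⇒ b` applies the term to a fresh variable,
computable by the second claim at `a`; the second claim at `a ⇒ b` needs computable arguments to
terminate, which is the first claim at `a`. -/
theorem computable_aux (hpr : IsPrecedence pr) (a : Ty Unit) :
    (∀ s, Computable pr π a s → Terminates pr π s) ∧
      ∀ (x : Var S) (ss : List (PTerm S)), HasShape ((PTerm.var x).apps ss) a →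
        (∀ s ∈ ss, Terminates pr π s) → Computable pr π a ((PTerm.var x).apps ss) := by
  induction a with
  | base i => exact ⟨fun s hs => hs.2, fun x ss h hss => ⟨h, terminates_var_apps hpr x ss hss⟩⟩
  | arr a b iha ihb =>
    refine ⟨fun s hs => ?_, fun x ss h hss => ⟨h, fun t ht => ?_⟩⟩
    · obtain ⟨c, rfl⟩ := exists_shape_eq S a
      have hx := hs.2 _ (iha.2 ⟨c, 0⟩ [] (.var ⟨c, 0⟩) (by simp))
      exact (ihb.1 _ hx).of_app hpr hx.hasShape
    · rw [← apps_concat]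
      refine ihb.2 _ _ ?_ ?_
      · rw [apps_concat]
        exact .app h ht.hasShape
      · intro s hs
        rcases List.mem_append.1 hs with hs | hs
        · exact hss s hs
        · rw [List.mem_singleton.1 hs]
          exact iha.1 _ ht

theorem Computable.terminates (hpr : IsPrecedence pr) {a : Ty Unit} {s : PTerm S}
    (h : Computable pr π a s) : Terminates pr π s :=
  (computable_aux hpr a).1 s h

/-- Unfolding computability along the type structure leaves termination of all saturations by
computable arguments, so symbols need only be studied fully applied. -/
theorem computable_of_terminates_apps {h : PTerm S} {ts : List (PTerm S)} {a : Ty Unit}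
    (hts : HasShape (h.apps ts) a)
    (H : ∀ us : List (PTerm S), (∀ r ∈ us, ∃ b, Computable pr π b r) →
      HasShape (h.apps (ts ++ us)) (.base ()) → Terminates pr π (h.apps (ts ++ us))) :
    Computable pr π a (h.apps ts) := by
  induction a generalizing ts with
  | base i => exact ⟨hts, by simpa using H [] (by simp) (by simpa using hts)⟩
  | arr a b _ ih =>
    refine ⟨hts, fun t ht => ?_⟩
    rw [← apps_concat]
    refine ih ?_ fun us hus hsh => ?_
    · rw [apps_concat]
      exact .app hts ht.hasShape
    · rw [List.append_assoc] at hsh ⊢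
      refine H _ (fun r hr => ?_) hsh
      rcases List.mem_append.1 hr with hr | hr
      · rw [List.mem_singleton.1 hr]
        exact ⟨_, ht⟩
      · exact hus r hr

/-- All regarded arguments are computable. -/
def ComputableArgs (pr : Sym S → Sym S → Prop) (π : Sym S → Set ℕ) (f : Sym S)
    (ss : List (PTerm S)) : Prop :=
  ∀ (i : ℕ) (h : i < ss.length), i ∈ π f → ∃ a, Computable pr π a ss[i]

theorem ComputableArgs.append {f : Sym S} {ss us : List (PTerm S)}
    (hss : ComputableArgs pr π f ss) (hus : ∀ r ∈ us, ∃ b, Computable pr π b r) :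
    ComputableArgs pr π f (ss ++ us) := by
  intro i h hi
  by_cases hlt : i < ss.length
  · rw [List.getElem_append_left hlt]
    exact hss i hlt hi
  · rw [List.getElem_append_right (by omega)]
    exact hus _ (List.getElem_mem _)

/-- The reducts of `f s₁ ⋯ sₙ` under `⊐⊐` are computable. -/
theorem computable_of_rpo (hpr : IsPrecedence pr) {f : Sym S} {ss : List (PTerm S)}
    (hss : ComputableArgs pr π f ss)
    (hcopy : ∀ g, Strict pr f g → ∀ ts, HasShape ((PTerm.fn g).apps ts) (.base ()) →
      ComputableArgs pr π g ts → Terminates pr π ((PTerm.fn g).apps ts))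
    (hlex : ∀ g, Equi pr f g → ∀ ts, HasShape ((PTerm.fn g).apps ts) (.base ()) →
      ComputableArgs pr π g ts →
      ∀ (i : ℕ) (h : i < ss.length) (h' : i < ts.length), i ∈ π f → i ∈ π g →
      (∀ j, j ≤ i → (j ∈ π f ↔ j ∈ π g)) →
      (∀ (j : ℕ) (hj : j < ss.length) (hj' : j < ts.length), j < i → j ∈ π f →
        Approx pr π ss[j] ts[j]) →
      Gt pr π ss[i] ts[i] → Terminates pr π ((PTerm.fn g).apps ts))
    {t : PTerm S} (h : Rpo pr π ((PTerm.fn f).apps ss) t) {a : Ty Unit} (ht : HasShape t a) :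
    Computable pr π a t := by
  generalize hs : (PTerm.fn f).apps ss = s at h
  induction h using Rpo.rec (motive_1 := fun _ _ _ => True) (motive_2 := fun _ _ _ => True)
    generalizing a with
  | approx => trivial
  | greater => trivial
  | mono => trivial
  | args => trivial
  | rpo => trivial
  | select f' ss' t h1 i h2 h3 h4 =>
    obtain ⟨rfl, rfl⟩ := PTerm.apps_fn_inj hs
    obtain ⟨b, hb⟩ := hss i h2 h3
    have hc := hb.of_ge hpr h4
    rwa [← hc.hasShape.unique ht]
  | appl f' ss' t₀ ts h1 _ _ ih1 ih2 =>
    -- Computable terms are closed under application by definition; uniqueness of type structures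
    -- makes the argument structures match.
    have key : ∀ rs : List (PTerm S), (∀ r ∈ rs, ∃ b, Computable pr π b r) →
        ∀ (q : PTerm S) (a : Ty Unit), (∃ b, Computable pr π b q) → HasShape (q.apps rs) a →
        Computable pr π a (q.apps rs) := by
      intro rs hrs
      induction rs with
      | nil =>
        rintro q a ⟨b, hb⟩ hq
        have hq : HasShape q a := hq
        show Computable pr π a q
        rwa [← hb.hasShape.unique hq]
      | cons r rs ih =>
        rintro q a ⟨b, hb⟩ hq
        obtain ⟨⟨c, hc, _⟩, _⟩ := HasShape.apps_inv (h := q.app r) (ss := rs) hq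
        obtain ⟨d, h3, h4⟩ := hc.app_inv
        cases hb.hasShape.unique h3
        obtain ⟨e, he⟩ := hrs r (by simp)
        cases he.hasShape.unique h4
        exact ih (fun r hr => hrs r (by simp [hr])) (q.app r) a ⟨_, hb.2 r he⟩ hq
    obtain ⟨⟨b, hb, _⟩, hts⟩ := ht.apps_inv
    refine key ts (fun t ht => ?_) t₀ a ⟨b, ih1 hb hs⟩ ht
    obtain ⟨c, hc⟩ := hts t ht
    exact ⟨c, ih2 t ht hc hs⟩
  | copy f' g ss' ts h1 h2 _ ih =>
    obtain ⟨rfl, rfl⟩ := PTerm.apps_fn_inj hs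
    have hargs : ComputableArgs pr π g ts := by
      intro i hi hig
      obtain ⟨c, hc⟩ := ht.getElem i hi
      exact ⟨c, ih i hi hig hc rfl⟩
    exact computable_of_terminates_apps ht fun us hus hsh =>
      hcopy g h2 _ hsh (hargs.append hus)
  | lex f' g ss' ts h1 h2 i h3 h4 h5 h6 h7 h8 h9 _ _ ih =>
    obtain ⟨rfl, rfl⟩ := PTerm.apps_fn_inj hs
    have hargs : ComputableArgs pr π g ts := by
      -- Computability is inherited through `≈` before position `i`, through `⊐` at `i`, and comes
      -- from the induction hypothesis for `⊐⊐` after `i`.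
      intro j hj hjg
      rcases lt_trichotomy j i with hji | rfl | hji
      · have hjf := (h7 j hji.le).2 hjg
        obtain ⟨b, hb⟩ := hss j (hji.trans h3) hjf
        exact ⟨b, hb.of_ge hpr (.approx (h8 j _ hj hji hjf))⟩
      · obtain ⟨b, hb⟩ := hss j h3 h5
        exact ⟨b, hb.of_ge hpr (.greater h9)⟩
      · obtain ⟨c, hc⟩ := ht.getElem j hj
        exact ⟨c, ih j hj hji hjg hc rfl⟩
    -- The saturating arguments stand behind all of `ts`, hence behind the decisive position, and
    -- leave the lexicographic comparison intact.
    refine computable_of_terminates_apps ht fun us hus hsh =>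
      hlex g h2 _ hsh (hargs.append hus) i h3 (by simp; omega) h5 h6 h7
        (fun j hj hj' hji hjf => ?_) ?_
    · rw [List.getElem_append_left (by omega)]
      exact h8 j _ _ hji hjf
    · rwa [List.getElem_append_left h4]

theorem terminates_fn_apps (hpr : IsPrecedence pr) (f : Sym S) (ss : List (PTerm S))
    (hsh : HasShape ((PTerm.fn f).apps ss) (.base ())) (hss : ComputableArgs pr π f ss) :
    Terminates pr π ((PTerm.fn f).apps ss) := by
  induction f using hpr.wf.induction generalizing ss with
  | h f ihf =>
  obtain ⟨N, hN⟩ := hpr.arity_bounded f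
  -- Stated for the whole `≡`-class of `f`, because Rpo-lex and Gr-args may exchange the head for an
  -- equivalent symbol. The common bound `N` makes the tuples comparable.
  have key : ∀ (m : Fin N → Ordinal.{max u v w}) (g : Sym S) (ss : List (PTerm S)), Equi pr f g →
      m = argRanks pr π N (π g) ss → HasShape ((PTerm.fn g).apps ss) (.base ()) →
      ComputableArgs pr π g ss → Terminates pr π ((PTerm.fn g).apps ss) := by
    intro m
    induction m using argRanks_induction with
    | h m ih =>
    rintro g ss hg rfl hsh hss
    have hlt : ∀ i < ss.length, i < N := by
      intro i hi
      have := hsh.fn_arity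
      have := hN g hg
      omega
    have hlex : ∀ g', Equi pr g g' → ∀ ts, HasShape ((PTerm.fn g').apps ts) (.base ()) →
        ComputableArgs pr π g' ts →
        ∀ (i : ℕ) (h : i < ss.length) (h' : i < ts.length), i ∈ π g → i ∈ π g' →
        (∀ j, j ≤ i → (j ∈ π g ↔ j ∈ π g')) →
        (∀ (j : ℕ) (hj : j < ss.length) (hj' : j < ts.length), j < i → j ∈ π g →
          Approx pr π ss[j] ts[j]) →
        Gt pr π ss[i] ts[i] → Terminates pr π ((PTerm.fn g').apps ts) := by
      intro g' hg' ts hts hargs i h h' hi hi' hiff heq hgt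
      obtain ⟨b, hb⟩ := hss i h hi
      exact ih _ (argRanks_lt hpr i (hlt i h) h h' hi hi' hiff heq hgt (hb.terminates hpr)) g' ts
        (hpr.equi_trans _ _ _ hg hg') rfl hts hargs
    refine ⟨_, fun t ht => ?_⟩
    generalize hs : (PTerm.fn g).apps ss = s at ht
    cases ht with
    | mono => exact absurd hs.symm PTerm.apps_var_ne_fn
    | rpo h1 h2 =>
      subst hs
      obtain ⟨b, _, hb⟩ := h1
      exact (computable_of_rpo hpr hss
        (fun g' hg' => ihf g' (hpr.equi_strict _ _ _ hg hg')) hlex h2 hb).terminates hpr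
    | args g₁ g' ss₁ ts h1 h2 h3 h4 h5 h6 i h7 h8 h9 h10 =>
      obtain ⟨rfl, rfl⟩ := PTerm.apps_fn_inj hs
      obtain ⟨k, k1, k2, _, k3, k4, k5⟩ := exists_first_gt h6 i h7 h8 h9 h10
      obtain ⟨b, hb, hb'⟩ := h1
      cases hb.unique hsh
      -- Gr-args is reduced to the lexicographic situation by cutting at its first strict decrease.
      refine hlex g' h4 ts hb' (fun j hj hjg => ?_) k k1 k2 k3 (h5 ▸ k3) (fun j _ => by rw [h5])
        k5 k4
      obtain ⟨c, hc⟩ := hss j (h2 ▸ hj) (h5 ▸ hjg)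
      exact ⟨c, hc.of_ge hpr (h6 j _ hj (h5 ▸ hjg))⟩
  exact key _ f ss ⟨hpr.refl f, hpr.refl f⟩ rfl hsh hss

theorem HasShape.computable (hpr : IsPrecedence pr) {s : PTerm S} {a : Ty Unit}
    (h : HasShape s a) : Computable pr π a s := by
  induction h with
  | var x => exact (computable_aux hpr _).2 x [] (.var x) (by simp)
  | fn f =>
    refine computable_of_terminates_apps (h := .fn f) (ts := []) (.fn f) fun us hus hsh => ?_
    exact terminates_fn_apps hpr f us hsh fun i hi _ => hus _ (List.getElem_mem _)
  | app _ _ ih1 ih2 => exact ih1.2 _ ih2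

/-! ### The extended precedence -/

namespace Ingredients

variable (D : Ingredients S)

theorem not_onValues_vgt_symm {v₁ v₂ : Sym S} (h : OnValues D.vgt v₁ v₂) :
    ¬ OnValues D.vgt v₂ v₁ := by
  obtain ⟨i, hi, a, b, h⟩ := h
  rintro ⟨_, _, _, _, h'⟩
  exact (D.vgt_wf i).asymmetric _ _ h h'

/-- `MinimalValue` holds vacuously of non-value symbols, so the last alternative must record
separately that `g` is a value. -/
theorem precExt_val_iff {i : S.Srt} {hi : i ∈ S.theorySort} {a : S.carrier i} {g : Sym S} :
    D.precExt (.val i hi a) g ↔ OnValues D.vgt (.val i hi a) g ∨ Sym.val i hi a = g ∨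
      (D.MinimalValue (.val i hi a) ∧ D.MinimalValue g ∧ ∃ j hj b, g = .val j hj b) := by
  cases g with
  | op g =>
    simp only [precExt, false_iff]
    rintro (h | h | ⟨_, _, _, _, _, h⟩) <;> cases h
  | val j hj b =>
    simp only [precExt]
    exact or_congr_right (or_congr_right
      ⟨fun h => ⟨h.1, h.2, j, hj, b, rfl⟩, fun h => ⟨h.1, h.2.1⟩⟩)

theorem equi_val {i : S.Srt} {hi : i ∈ S.theorySort} {a : S.carrier i} {g : Sym S}
    (h : Equi D.precExt (.val i hi a) g) : Sym.val i hi a = g ∨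
      (D.MinimalValue (.val i hi a) ∧ D.MinimalValue g ∧ ∃ j hj b, g = .val j hj b) := by
  obtain ⟨h1, h2⟩ := h
  rcases D.precExt_val_iff.1 h1 with h | h | h
  · obtain ⟨i, hi, a, b, hab⟩ := h
    rcases D.precExt_val_iff.1 h2 with k | k | k
    · exact absurd k (D.not_onValues_vgt_symm ⟨i, hi, a, b, hab⟩)
    · exact .inl k.symm
    · exact absurd ⟨i, hi, a, b, hab⟩ (k.2.1 _)
  · exact .inl h
  · exact .inr h

theorem strict_val {i : S.Srt} {hi : i ∈ S.theorySort} {a : S.carrier i} {g : Sym S} :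
    Strict D.precExt (.val i hi a) g ↔ OnValues D.vgt (.val i hi a) g := by
  constructor
  · rintro ⟨h1, h2⟩
    rcases D.precExt_val_iff.1 h1 with h | rfl | ⟨h, k, j, hj, b, rfl⟩
    · exact h
    · exact absurd h1 h2
    · exact absurd (D.precExt_val_iff.2 (.inr (.inr ⟨k, h, _, _, _, rfl⟩))) h2
  · intro h
    refine ⟨D.precExt_val_iff.2 (.inl h), fun h' => ?_⟩
    have h0 := h
    obtain ⟨i, hi, a, b, _⟩ := h
    rcases D.precExt_val_iff.1 h' with k | k | k
    · exact D.not_onValues_vgt_symm h0 k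
    · rw [k] at h0
      exact D.not_onValues_vgt_symm h0 h0
    · exact k.2.1 _ h0

theorem strict_op_val (f : S.Op) (i : S.Srt) (hi : i ∈ S.theorySort) (a : S.carrier i) :
    Strict D.precExt (.op f) (.val i hi a) :=
  ⟨trivial, id⟩

/-- The extended `⊵` need not be transitive: a value can lie above one minimal value without lying
above another, although the two are equivalent. `IsPrecedence` therefore asks only for compositions
with `≡` on the left. These hold because distinct equivalent values are minimal and so have nothing
strictly below them. -/
theorem isPrecedence : IsPrecedence D.precExt where
  refl f := by
    cases f with
    | op f => exact D.prec_refl f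
    | val i hi a => exact .inr (.inl rfl)
  equi_trans f g h hfg hgh := by
    cases f with
    | op f =>
      cases g with
      | val => exact hfg.2.elim
      | op g =>
        cases h with
        | val => exact hgh.2.elim
        | op h => exact ⟨D.prec_trans _ _ _ hfg.1 hgh.1, D.prec_trans _ _ _ hgh.2 hfg.2⟩
    | val i hi a =>
      rcases D.equi_val hfg with rfl | ⟨h1, h2, j, hj, b, rfl⟩
      · exact hgh
      · rcases D.equi_val hgh with rfl | ⟨_, h4, j, hj, b, rfl⟩
        · exact hfg
        · exact ⟨.inr (.inr ⟨h1, h4⟩), .inr (.inr ⟨h4, h1⟩)⟩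
  equi_strict f g h hfg hgh := by
    cases f with
    | op f =>
      cases g with
      | val => exact hfg.2.elim
      | op g =>
        cases h with
        | val => exact D.strict_op_val _ _ _ _
        | op h =>
          exact ⟨D.prec_trans _ _ _ hfg.1 hgh.1, fun k => hgh.2 (D.prec_trans _ _ _ k hfg.1)⟩
    | val i hi a =>
      rcases D.equi_val hfg with rfl | ⟨_, h2, j, hj, b, rfl⟩
      · exact hgh
      · exact absurd (D.strict_val.1 hgh) (h2 _)
  wf := by
    -- Below a value there are only values, ordered by `▶`; they must be accessible before the
    -- non-value symbols, which lie above all of them.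
    have hval : ∀ i hi a, Acc (fun g f => Strict D.precExt f g) (Sym.val i hi a) := by
      intro i hi a
      induction a using (D.vgt_wf i).induction with
      | h a ih =>
      refine ⟨_, fun g hg => ?_⟩
      obtain ⟨_, _, _, b, h⟩ := D.strict_val.1 hg
      exact ih b h
    refine ⟨fun f => ?_⟩
    cases f with
    | val i hi a => exact hval i hi a
    | op f =>
      induction f using D.prec_wf.induction with
      | h f ih =>
      refine ⟨_, fun g hg => ?_⟩
      cases g with
      | val i hi a => exact hval i hi a
      | op g => exact ih g hg
  arity_bounded f := by
    cases f with
    | op f =>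
      obtain ⟨N, hN⟩ := D.arity_bounded f
      refine ⟨N, fun g hg => ?_⟩
      cases g with
      | val => exact hg.2.elim
      | op g => exact hN g hg
    | val i hi a =>
      refine ⟨0, fun g hg => ?_⟩
      rcases D.equi_val hg with rfl | ⟨_, _, j, hj, b, rfl⟩ <;> exact le_rfl

end Ingredients

/-! ### Normal forms of instances -/

theorem RootStep.isTheory {s t : PTerm S} (h : RootStep s t) : s.IsTheory := by
  obtain ⟨f, hf, vs, hvs, rfl, _⟩ := h
  refine PTerm.isTheory_apps.2 ⟨hf, fun v hv => ?_⟩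
  obtain ⟨i, hi, a, rfl⟩ := hvs v hv
  trivial

theorem contract_cases (s : PTerm S) :
    (∃ i hi a, contract s = .fn (.val i hi a) ∧ RootStep s (.fn (.val i hi a))) ∨
      contract s = s := by
  by_cases hr : ∃ u, RootStep s u
  · obtain ⟨u, hu⟩ := hr
    rw [contract_of_rootStep hu]
    have hu' := hu
    obtain ⟨_, _, _, _, _, i, hi, x, _, rfl⟩ := hu
    exact .inl ⟨i, hi, x, rfl, hu'⟩
  · exact .inr (contract_of_not hr)

/-- Calculation contracts only theory subterms, so it cannot remove a symbol that is not a theory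
symbol. -/
theorem isTheory_of_knf {s : PTerm S} (h : (knf s).IsTheory) : s.IsTheory := by
  induction s with
  | var x => exact h
  | fn f => exact h
  | app s t ihs iht =>
    rw [knf] at h
    have h' : (PTerm.app (knf s) (knf t)).IsTheory := by
      rcases contract_cases (.app (knf s) (knf t)) with ⟨_, _, _, _, k⟩ | k
      · exact k.isTheory
      · rwa [k] at h
    exact ⟨ihs h'.1, iht h'.2⟩

theorem isTheory_of_subst {γ : Var S → PTerm S} {s : PTerm S} (h : (s.subst γ).IsTheory) :
    s.IsTheory := by
  induction s with
  | var x => trivial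
  | fn f => exact h
  | app s t ihs iht => exact ⟨ihs h.1, iht h.2⟩

/-- Redexes have a sort as type while proper prefixes of an application have arrow structure, so
after normalising head and arguments only the entire application can still be contracted. -/
theorem knf_apps {h : PTerm S} {ss : List (PTerm S)} {a : Ty Unit} (hs : HasShape (h.apps ss) a) :
    knf (h.apps ss) = contract ((knf h).apps (ss.map knf)) := by
  induction ss using List.reverseRecOn generalizing a with
  | nil => exact (contract_of_not fun ⟨u, hu⟩ => knf_normal h u (.root hu)).symm
  | append_singleton ss s ih =>
    rw [apps_concat] at hs
    obtain ⟨b, h1, h2⟩ := hs.app_inv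
    rw [List.map_append, List.map_singleton, apps_concat, apps_concat, knf, ih h1]
    rcases contract_cases ((knf h).apps (ss.map knf)) with ⟨i, hi, x, k1, k2⟩ | k
    · have h3 := h1.knf
      rw [ih h1, k1] at h3
      cases h3
    · rw [k]

theorem KStep.subst {s t : PTerm S} (h : KStep s t) (γ : Var S → PTerm S) :
    KStep (s.subst γ) (t.subst γ) := by
  induction h with
  | @root s t h =>
    refine .root ?_
    have hs : s.subst γ = s ∧ t.subst γ = t := by
      obtain ⟨f, hf, vs, hvs, rfl, i, hi, x, e, rfl⟩ := h
      refine ⟨?_, rfl⟩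
      rw [PTerm.subst_apps]
      refine congrArg _ ((List.map_congr_left fun v hv => ?_).trans (List.map_id vs))
      obtain ⟨i, hi, a, rfl⟩ := hvs v hv
      rfl
    rwa [hs.1, hs.2]
  | left t _ ih => exact .left _ ih
  | right s _ ih => exact .right _ ih

/-- Redexes are ground, so calculation is stable under substitution. This serves the Eq clause. -/
theorem knf_subst_knf (s : PTerm S) (γ : Var S → PTerm S) :
    knf ((knf s).subst γ) = knf (s.subst γ) := by
  have h := knf_reach s
  generalize knf s = u at h
  induction h with
  | refl => rfl
  | tail _ h ih => rw [← ih, knf_kStep (h.subst γ)]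

theorem PTerm.IsGroundTheory.app {s t : PTerm S} (hs : s.IsGroundTheory) (ht : t.IsGroundTheory) :
    (PTerm.app s t).IsGroundTheory :=
  ⟨⟨hs.1, ht.1⟩, by simp [PTerm.vars, hs.2, ht.2]⟩

theorem PTerm.isGroundTheory_app {s t : PTerm S} :
    (PTerm.app s t).IsGroundTheory ↔ s.IsGroundTheory ∧ t.IsGroundTheory := by
  simp only [IsGroundTheory, IsTheory, vars, Set.union_empty_iff]
  tauto

theorem PTerm.IsGroundTheory.subst {s : PTerm S} {γ : Var S → PTerm S} (hs : s.IsTheory)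
    (hγ : ∀ x ∈ s.vars, (γ x).IsGroundTheory) : (s.subst γ).IsGroundTheory := by
  induction s with
  | var x => exact hγ x rfl
  | fn f => exact ⟨hs, rfl⟩
  | app s t ihs iht =>
    exact .app (ihs hs.1 fun x hx => hγ x (.inl hx)) (iht hs.2 fun x hx => hγ x (.inr hx))

theorem PTerm.IsGroundTheory.knf {s : PTerm S} (hs : s.IsGroundTheory) :
    (knf s).IsGroundTheory := by
  induction s with
  | var x => exact hs
  | fn f => exact hs
  | app s t ihs iht =>
    obtain ⟨h1, h2⟩ := PTerm.isGroundTheory_app.1 hs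
    rw [LCSTRS.knf]
    rcases contract_cases (.app (LCSTRS.knf s) (LCSTRS.knf t)) with ⟨_, _, _, k, _⟩ | k
    · rw [k]
      exact ⟨trivial, rfl⟩
    · rw [k]
      exact .app (ihs h1) (iht h2)

theorem exists_eval {s : PTerm S} {a : Ty S.Srt} (hs : s.IsGroundTheory) (h : HasType s a) :
    ∃ x, Eval s a x := by
  induction h with
  | var x => exact absurd hs.2 (Set.singleton_ne_empty x)
  | fn f =>
    cases f with
    | val i hi a => exact ⟨_, .val i hi a⟩
    | op f => exact ⟨_, .op f hs.1⟩
  | app _ _ ih1 ih2 =>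
    obtain ⟨h1, h2⟩ := PTerm.isGroundTheory_app.1 hs
    obtain ⟨F, hF⟩ := ih1 h1
    obtain ⟨x, hx⟩ := ih2 h2
    exact ⟨_, .app hF hx⟩

/-- The shape of the normal form of a ground theory term of type `a`. -/
def IsTheoryNormal (s : PTerm S) : Ty S.Srt → Prop
  | .base _ => s.IsValue
  | .arr _ _ => ∃ f ∈ S.theoryOp, ∃ vs : List (PTerm S), (∀ v ∈ vs, v.IsValue) ∧
      s = (PTerm.fn (.op f)).apps vs

/-- Theory types take only sorts as arguments, so arguments normalise to values. A theory symbol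
then accumulates values until its type is a sort, when it is calculated. -/
theorem isTheoryNormal_knf {s : PTerm S} {a : Ty S.Srt} (hs : s.IsGroundTheory)
    (h : HasType s a) : a.IsTheory S.theorySort ∧ IsTheoryNormal (knf s) a := by
  induction h with
  | var x => exact absurd hs.2 (Set.singleton_ne_empty x)
  | fn f =>
    cases f with
    | val i hi a => exact ⟨.base hi, i, hi, a, rfl⟩
    | op f =>
      refine ⟨S.theoryOp_ty f hs.1, ?_⟩
      simp only [Sym.ty]
      cases hty : S.ty f with
      | base i => exact absurd hty (S.theoryOp_ne_base f hs.1 i)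
      | arr a b => exact ⟨f, hs.1, [], by simp, rfl⟩
  | @app s t a b hs' ht' ih1 ih2 =>
    obtain ⟨h1, h2⟩ := PTerm.isGroundTheory_app.1 hs
    obtain ⟨k1, f, hf, vs, hvs, k2⟩ := ih1 h1
    obtain ⟨_, k3⟩ := ih2 h2
    cases k1 with
    | @arr i _ hi hb =>
    refine ⟨hb, ?_⟩
    have hvs' : ∀ v ∈ vs ++ [knf t], v.IsValue := by
      intro v hv
      rcases List.mem_append.1 hv with hv | hv
      · exact hvs v hv
      · rw [List.mem_singleton.1 hv]
        exact k3
    have happ : PTerm.app (knf s) (knf t) = (PTerm.fn (.op f)).apps (vs ++ [knf t]) := by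
      rw [k2, apps_concat]
    obtain ⟨x, hx⟩ := exists_eval (h1.knf.app h2.knf) (hs'.knf.app ht'.knf)
    rw [knf]
    cases hb with
    | @base j hj =>
      rw [contract_of_rootStep ⟨f, hf, _, hvs', happ, j, hj, x, hx, rfl⟩]
      exact ⟨j, hj, x, rfl⟩
    | arr hj hb =>
      rw [contract_of_not]
      · exact ⟨f, hf, _, hvs', happ⟩
      · rintro ⟨u, _, _, _, _, _, j, hj, y, e, _⟩
        cases (e.unique hx).1

/-! ### Unconstrained HORPO covers constrained HORPO -/

theorem Ge.fn_apps {pr : Sym S → Sym S → Prop} {π : Sym S → Set ℕ} {f g : Sym S}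
    {ss ts : List (PTerm S)}
    (hsh : SameShape ((PTerm.fn f).apps ss) ((PTerm.fn g).apps ts)) (hlen : ss.length = ts.length)
    (hty : f.ty.shape = g.ty.shape) (hfg : Equi pr f g) (hπ : π f = π g)
    (hst : ∀ (i : ℕ) (h : i < ss.length) (h' : i < ts.length), i ∈ π f → Ge pr π ss[i] ts[i]) :
    Ge pr π ((PTerm.fn f).apps ss) ((PTerm.fn g).apps ts) := by
  by_cases hex : ∃ (i : ℕ) (h : i < ss.length) (h' : i < ts.length), i ∈ π f ∧
      Gt pr π ss[i] ts[i]
  · obtain ⟨i, h, h', hi, hgt⟩ := hex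
    exact .greater (.args f g ss ts hsh hlen hty hfg hπ hst i h h' hi hgt)
  · refine .approx (.args f g ss ts hsh hlen hty hfg hπ fun i h h' hi => ?_)
    rcases hst i h h' hi with k | k
    · exact k
    · exact absurd ⟨i, h, h', hi, k⟩ hex

theorem PTerm.eq_apps_of_head {s : PTerm S} {f : Sym S} (h : s.head = .fn f) :
    s = (PTerm.fn f).apps s.args := by
  induction s with
  | var x => cases h
  | fn g => exact h
  | app s t ih _ => rw [PTerm.args, apps_concat, ← ih h]

/-- The normal form of an instance. -/
noncomputable def inst (γ : Subst S) (s : PTerm S) : PTerm S := knf (s.subst γ.toFun)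

theorem inst_apps (γ : Subst S) {h : PTerm S} {ss : List (PTerm S)} {a : Ty Unit}
    (hs : HasShape (h.apps ss) a) :
    inst γ (h.apps ss) = contract ((inst γ h).apps (ss.map (inst γ))) := by
  have hs' := hs.subst γ
  rw [PTerm.subst_apps] at hs'
  rw [inst, PTerm.subst_apps, knf_apps hs', List.map_map]
  rfl

/-- A calculation at the root would need the normalised instance to be a theory term; neither
normalisation nor substitution can turn a non-theory term into one. -/
theorem inst_apps_of_not_isTheory (γ : Subst S) {h : PTerm S} {ss : List (PTerm S)} {a : Ty Unit}
    (hs : HasShape (h.apps ss) a) (hth : ¬ (h.apps ss).IsTheory) :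
    inst γ (h.apps ss) = (inst γ h).apps (ss.map (inst γ)) := by
  rw [inst_apps γ hs]
  refine contract_of_not fun ⟨u, hu⟩ => hth ?_
  have hth' := PTerm.isTheory_apps.1 hu.isTheory
  refine PTerm.isTheory_apps.2 ⟨isTheory_of_subst (isTheory_of_knf hth'.1), fun s hs => ?_⟩
  exact isTheory_of_subst (isTheory_of_knf (hth'.2 _ (List.mem_map_of_mem hs)))

theorem inst_fn_apps_of_not_isTheory (γ : Subst S) {f : Sym S} {ss : List (PTerm S)} {a : Ty Unit}
    (hs : HasShape ((PTerm.fn f).apps ss) a) (hth : ¬ ((PTerm.fn f).apps ss).IsTheory) :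
    inst γ ((PTerm.fn f).apps ss) = (PTerm.fn f).apps (ss.map (inst γ)) :=
  inst_apps_of_not_isTheory γ hs hth

theorem SameShape.inst {s t : PTerm S} (h : SameShape s t) (γ : Subst S) :
    SameShape (inst γ s) (inst γ t) := by
  obtain ⟨a, h1, h2⟩ := h
  exact ⟨a, (h1.subst γ).knf, (h2.subst γ).knf⟩

namespace Ingredients

variable (D : Ingredients S)

theorem rpo_val {f : S.Op} {ss : List (PTerm S)}
    (hf : ∀ j, ss.length ≤ j → j < (S.ty f).arity → j ∈ D.filter f) (i : S.Srt)
    (hi : i ∈ S.theorySort) (a : S.carrier i) :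
    Rpo D.precExt D.filterExt ((PTerm.fn (.op f)).apps ss) (.fn (.val i hi a)) :=
  .copy (.op f) (.val i hi a) ss [] hf (D.strict_op_val f i hi a) (by simp)

/-- Fully applied `f` is greater than every value. -/
theorem gt_val {f : S.Op} {ss : List (PTerm S)}
    (hs : HasShape ((PTerm.fn (.op f)).apps ss) (.base ())) (i : S.Srt)
    (hi : i ∈ S.theorySort) (a : S.carrier i) :
    Gt D.precExt D.filterExt ((PTerm.fn (.op f)).apps ss) (.fn (.val i hi a)) := by
  refine .rpo ⟨_, hs, .fn (.val i hi a)⟩ (D.rpo_val (fun j hj hj' => ?_) i hi a)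
  have har : (S.ty f).arity = ss.length + 0 := hs.fn_arity
  omega

theorem gt_of_rootStep {s t : PTerm S} (h : RootStep s t) : Gt D.precExt D.filterExt s t := by
  have hs := h.hasShape.1
  obtain ⟨f, hf, vs, _, rfl, i, hi, x, _, rfl⟩ := h
  exact D.gt_val hs i hi x

theorem ge_of_kStep {s t : PTerm S} (h : KStep s t) {a : Ty Unit} (hs : HasShape s a) :
    Ge D.precExt D.filterExt s t := by
  induction h generalizing a with
  | root h => exact .greater (D.gt_of_rootStep h)
  | left t _ ih =>
    obtain ⟨b, h1, h2⟩ := hs.app_inv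
    exact (ih h1).app (.approx (.refl D.isPrecedence.refl h2)) hs
  | right s _ ih =>
    obtain ⟨b, h1, h2⟩ := hs.app_inv
    exact Ge.app (.approx (.refl D.isPrecedence.refl h1)) (ih h2) hs

theorem gt_of_vgt {v₁ v₂ : Sym S} (h : OnValues D.vgt v₁ v₂) :
    Gt D.precExt D.filterExt (.fn v₁) (.fn v₂) := by
  obtain ⟨i, hi, a, b, hab⟩ := h
  refine .rpo ⟨_, .fn (.val i hi a), .fn (.val i hi b)⟩
    (.copy (.val i hi a) (.val i hi b) [] [] (fun j _ hj => ?_)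
      (D.strict_val.2 ⟨i, hi, a, b, hab⟩) (by simp))
  simp [Sym.ty, Ty.arity] at hj

theorem ge_of_vge {v₁ v₂ : Sym S} (h : OnValues D.vge v₁ v₂) :
    Ge D.precExt D.filterExt (.fn v₁) (.fn v₂) := by
  obtain ⟨i, hi, a, b, hab⟩ := h
  have key : Equi D.precExt (.val i hi a) (.val i hi b) →
      Ge D.precExt D.filterExt (.fn (.val i hi a)) (.fn (.val i hi b)) := fun k =>
    .approx (.args (.val i hi a) (.val i hi b) [] []
      ⟨_, .fn (.val i hi a), .fn (.val i hi b)⟩ rfl rfl k rfl (by simp))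
  rcases D.vge_imp i a b hab with h | rfl | ⟨h1, h2⟩
  · exact .greater (D.gt_of_vgt ⟨i, hi, a, b, h⟩)
  · exact key ⟨D.isPrecedence.refl _, D.isPrecedence.refl _⟩
  · have m1 : D.MinimalValue (.val i hi a) := by
      rintro _ ⟨_, _, _, c, h⟩
      exact h1 c h
    have m2 : D.MinimalValue (.val i hi b) := by
      rintro _ ⟨_, _, _, c, h⟩
      exact h2 c h
    exact key ⟨.inr (.inr ⟨m1, m2⟩), .inr (.inr ⟨m2, m1⟩)⟩

variable {D} {φ : Constraint S} {L : Set (Var S)}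

/-- A fully or partially applied `f` whose remaining arguments are all regarded is greater than
every contraction. -/
theorem rpo_contract {f : S.Op} {ss : List (PTerm S)} {t : PTerm S}
    (hf : ∀ j, ss.length ≤ j → j < (S.ty f).arity → j ∈ D.filter f)
    (h : contract t = t → Rpo D.precExt D.filterExt ((PTerm.fn (.op f)).apps ss) t) :
    Rpo D.precExt D.filterExt ((PTerm.fn (.op f)).apps ss) (contract t) := by
  rcases contract_cases t with ⟨i, hi, a, k, _⟩ | k
  · rw [k]
    exact D.rpo_val hf i hi a
  · rw [k]
    exact h k

theorem entails_inst {γ : Subst S} (hφ : Respects γ φ)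
    (hL : ∀ x ∈ L, (γ.toFun x).IsGroundTheory) {r : ∀ i, S.carrier i → S.carrier i → Prop}
    {s t : PTerm S} (hst : s.vars ∪ t.vars ⊆ L) (h : Entails φ r s t) :
    ∃ v₁ v₂, inst γ s = .fn v₁ ∧ inst γ t = .fn v₂ ∧ OnValues r v₁ v₂ :=
  h γ hφ fun x hx => hL x (hst hx)

/-- The case where both sides are applications of equivalent function symbols. -/
theorem inst_args {γ : Subst S} {f g : S.Op} {ss ts : List (PTerm S)}
    (hsh : SameShape ((PTerm.fn (.op f)).apps ss) ((PTerm.fn (.op g)).apps ts))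
    (hth : ¬ ((PTerm.fn (.op f)).apps ss).IsTheory) :
    Gt D.precExt D.filterExt (inst γ ((PTerm.fn (.op f)).apps ss))
        (inst γ ((PTerm.fn (.op g)).apps ts)) ∨
      (inst γ ((PTerm.fn (.op f)).apps ss) = (PTerm.fn (.op f)).apps (ss.map (inst γ)) ∧
        inst γ ((PTerm.fn (.op g)).apps ts) = (PTerm.fn (.op g)).apps (ts.map (inst γ)) ∧
        SameShape ((PTerm.fn (.op f)).apps (ss.map (inst γ)))
          ((PTerm.fn (.op g)).apps (ts.map (inst γ)))) := by
  have hsh' := hsh.inst γ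
  obtain ⟨a, h1, h2⟩ := hsh
  have e1 : inst γ ((PTerm.fn (.op f)).apps ss) = (PTerm.fn (.op f)).apps (ss.map (inst γ)) :=
    inst_apps_of_not_isTheory γ h1 hth
  have e2 : inst γ ((PTerm.fn (.op g)).apps ts) =
      contract ((PTerm.fn (.op g)).apps (ts.map (inst γ))) := inst_apps γ h2
  -- If the right-hand side collapses to a value, the left-hand side has base structure, so `f` is
  -- fully applied and exceeds that value.
  rcases contract_cases ((PTerm.fn (.op g)).apps (ts.map (inst γ))) with ⟨i, hi, x, k, k'⟩ | k
  · left
    rw [e1, e2, k] at hsh'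
    rw [e1, e2, k]
    obtain ⟨b, h3, h4⟩ := hsh'
    cases h4
    exact D.gt_val h3 i hi x
  · rw [k] at e2
    rw [e1, e2] at hsh'
    exact .inr ⟨e1, e2, hsh'⟩

/-- The instance of `x` may be any term, so monotonicity is used instead of Gr-mono. If the
right-hand side collapses, that instance is headed by a theory symbol; the left-hand side is then a
full application of this symbol and exceeds the value. -/
theorem inst_mono {γ : Subst S} {x : Var S} {ss ts : List (PTerm S)}
    (hsh : SameShape ((PTerm.var x).apps ss) ((PTerm.var x).apps ts))
    (hth : ¬ ((PTerm.var x).apps ss).IsTheory) (hlen : ss.length = ts.length)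
    (hst : ∀ (i : ℕ) (h : i < ss.length) (h' : i < ts.length),
      Ge D.precExt D.filterExt (inst γ ss[i]) (inst γ ts[i])) :
    Ge D.precExt D.filterExt (inst γ ((PTerm.var x).apps ss)) (inst γ ((PTerm.var x).apps ts)) := by
  have hsh' := hsh.inst γ
  obtain ⟨a, h1, h2⟩ := hsh
  have e1 := inst_apps_of_not_isTheory γ h1 hth
  have e2 := inst_apps γ h2
  rcases contract_cases ((inst γ (.var x)).apps (ts.map (inst γ))) with ⟨i, hi, v, k, k'⟩ | k
  · obtain ⟨f, hf, vs, hvs, hvs', _⟩ := k'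
    have hhead : (inst γ (.var x)).head = .fn (.op f) := by
      have := congrArg PTerm.head hvs'
      rwa [PTerm.head_apps, PTerm.head_apps] at this
    rw [PTerm.eq_apps_of_head hhead, ← PTerm.apps_append] at e1
    rw [e1, e2, k] at hsh'
    rw [e1, e2, k]
    obtain ⟨b, h3, h4⟩ := hsh'
    cases h4
    exact .greater (D.gt_val h3 i hi v)
  · rw [k] at e2
    rw [e1, e2] at hsh'
    rw [e1, e2]
    obtain ⟨b, h3, h4⟩ := hsh'
    refine Ge.apps _ D.isPrecedence.refl h3 (by simpa using hlen) fun i h h' => ?_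
    simpa using hst i (by simpa using h) (by simpa using h')

/-- The constrained clause allows `≽` before position `i`, whereas Rpo-lex wants `≈`. The first
strict decrease `k ≤ i` serves as decisive position instead. -/
theorem inst_rpo_lex {f g : S.Op} {ss ts : List (PTerm S)}
    (hf : ∀ j, ss.length ≤ j → j < (S.ty f).arity → j ∈ D.filter f) (hfg : Equi D.prec f g)
    (i : ℕ) (h : i < ss.length) (h' : i < ts.length) (hi : i ∈ D.filter f) (hi' : i ∈ D.filter g)
    (hiff : ∀ j, j ≤ i → (j ∈ D.filter f ↔ j ∈ D.filter g))
    (hge : ∀ (j : ℕ) (hj : j < ss.length) (hj' : j < ts.length), j < i → j ∈ D.filter f →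
      Ge D.precExt D.filterExt ss[j] ts[j])
    (hgt : Gt D.precExt D.filterExt ss[i] ts[i])
    (hrpo : ∀ (j : ℕ) (hj : j < ts.length), i < j → j ∈ D.filter g →
      Rpo D.precExt D.filterExt ((PTerm.fn (.op f)).apps ss) ts[j]) :
    Rpo D.precExt D.filterExt ((PTerm.fn (.op f)).apps ss) ((PTerm.fn (.op g)).apps ts) := by
  obtain ⟨k, k1, k2, k3, ⟨k4, _⟩, k5, k6⟩ := exists_first_gt (A := {j | j ∈ D.filter f ∧ j ≤ i})
    (fun j hj hj' ⟨hjf, hji⟩ => by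
      rcases hji.lt_or_eq with hji | rfl
      · exact hge j hj hj' hji hjf
      · exact .greater hgt) i h h' ⟨hi, le_rfl⟩ hgt
  refine .lex (.op f) (.op g) ss ts hf hfg k k1 k2 k4 ((hiff k k3).1 k4)
    (fun j hj => hiff j (hj.trans k3)) (fun j hj hj' hjk hjf => k6 j hj hj' hjk ⟨hjf, by omega⟩) k5
    fun j hj hkj hjg => ?_
  -- Positions after `k` up to `i` come without a `⊐⊐` hypothesis; selecting the argument of the
  -- left-hand side at the same position supplies one.
  rcases lt_trichotomy j i with hji | rfl | hji
  · have hjf := (hiff j hji.le).2 hjg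
    exact .select (.op f) ss _ hf j (hji.trans h) hjf (hge j _ hj hji hjf)
  · exact .select (.op f) ss _ hf j h hi (.greater hgt)
  · exact hrpo j hj hji hjg

-- Simultaneous induction over the three constrained relations. For `≻≻` the type structures of both
-- sides are carried separately, since that relation does not make them equal.
mutual

theorem ge_inst {γ : Subst S} (hφ : Respects γ φ) (hL : ∀ x ∈ L, (γ.toFun x).IsGroundTheory) :
    ∀ {s t : PTerm S}, CGe D φ L s t → Ge D.precExt D.filterExt (inst γ s) (inst γ t)
  | _, _, .theory _ _ _ _ _ _ _ hst h => by
    obtain ⟨v₁, v₂, e1, e2, hv⟩ := entails_inst hφ hL hst h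
    rw [e1, e2]
    exact D.ge_of_vge hv
  | _, _, .eq s t hsh h => by
    obtain ⟨a, h1, _⟩ := hsh
    have e : inst γ t = inst γ s := by
      rw [inst, inst, ← knf_subst_knf t, ← knf_subst_knf s, h]
    rw [e]
    exact .approx (.refl D.isPrecedence.refl (h1.subst γ).knf)
  | _, _, .mono _ _ _ hsh hth hlen h =>
    inst_mono hsh hth hlen fun i hi hi' => ge_inst hφ hL (h i hi hi')
  | _, _, .args f g ss ts hsh hth hlen hty hfg hπ h => by
    have ih := fun i hi hi' hif => ge_inst hφ hL (h i hi hi' hif)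
    rcases inst_args (D := D) (γ := γ) hsh hth with k | ⟨e1, e2, k⟩
    · exact .greater k
    · rw [e1, e2]
      refine Ge.fn_apps k (by simpa using hlen) hty hfg hπ fun i hi hi' hif => ?_
      simpa using ih i (by simpa using hi) (by simpa using hi') hif
  | _, _, .greater h => .greater (gt_inst hφ hL h)

theorem gt_inst {γ : Subst S} (hφ : Respects γ φ) (hL : ∀ x ∈ L, (γ.toFun x).IsGroundTheory) :
    ∀ {s t : PTerm S}, CGt D φ L s t → Gt D.precExt D.filterExt (inst γ s) (inst γ t)
  | _, _, .theory _ _ _ _ _ _ _ hst h => by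
    obtain ⟨v₁, v₂, e1, e2, hv⟩ := entails_inst hφ hL hst h
    rw [e1, e2]
    exact D.gt_of_vgt hv
  | _, _, .args f g ss ts hsh hth hlen hty hfg hπ h i hi hi' hif hgt => by
    have ih := fun i hi hi' hif => ge_inst hφ hL (h i hi hi' hif)
    have ih' := gt_inst hφ hL hgt
    rcases inst_args (D := D) (γ := γ) hsh hth with k | ⟨e1, e2, k⟩
    · exact k
    · rw [e1, e2]
      refine .args (.op f) (.op g) _ _ k (by simpa using hlen) hty hfg hπ
        (fun i hi hi' hif => ?_) i (by simpa using hi) (by simpa using hi') hif ?_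
      · simpa using ih i (by simpa using hi) (by simpa using hi') hif
      · simpa using ih'
  | _, _, .rpo hsh h =>
    .rpo (hsh.inst γ) (rpo_inst hφ hL h hsh.choose_spec.1 hsh.choose_spec.2)

theorem rpo_inst {γ : Subst S} (hφ : Respects γ φ) (hL : ∀ x ∈ L, (γ.toFun x).IsGroundTheory) :
    ∀ {s t : PTerm S}, CRpo D φ L s t → ∀ {a b : Ty Unit}, HasShape s a → HasShape t b →
      Rpo D.precExt D.filterExt (inst γ s) (inst γ t)
  | _, _, .select f ss t hth hf i hi hif h => fun hs _ => by
    have ih := ge_inst hφ hL h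
    rw [inst_fn_apps_of_not_isTheory γ hs hth]
    exact .select (.op f) _ _ (fun j hj => hf j (by simpa using hj)) i (by simpa using hi) hif (by simpa using ih)
  | _, _, .appl f ss t₀ ts hth hf h h' => fun hs ht => by
    obtain ⟨⟨b, hb, _⟩, hts⟩ := ht.apps_inv
    have ih := rpo_inst hφ hL h hs hb
    have ih' : ∀ t ∈ ts, Rpo D.precExt D.filterExt (inst γ ((PTerm.fn (.op f)).apps ss))
        (inst γ t) := fun t ht => rpo_inst hφ hL (h' t ht) hs (hts t ht).choose_spec
    rw [inst_apps γ ht]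
    rw [inst_fn_apps_of_not_isTheory γ hs hth] at ih ih' ⊢
    refine rpo_contract (fun j hj => hf j (by simpa using hj)) fun _ => ?_
    refine .appl (.op f) _ _ _ (fun j hj => hf j (by simpa using hj)) ih fun t ht => ?_
    obtain ⟨t, ht', rfl⟩ := List.mem_map.1 ht
    exact ih' t ht'
  | _, _, .copy f g ss ts hth hf hfg h => fun hs ht => by
    have ih := fun i hi hig => rpo_inst hφ hL (h i hi hig) hs (ht.getElem i hi).choose_spec
    rw [inst_apps γ ht]
    rw [inst_fn_apps_of_not_isTheory γ hs hth] at ih ⊢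
    refine rpo_contract (fun j hj => hf j (by simpa using hj)) fun _ => ?_
    refine .copy (.op f) (.op g) _ _ (fun j hj => hf j (by simpa using hj)) hfg fun i hi hig => ?_
    simpa using ih i (by simpa using hi) hig
  | _, _, .lex f g ss ts hth hf hfg i hi hi' hif hig hiff hge hgt h => fun hs ht => by
    have ih := fun j hj hij hjg => rpo_inst hφ hL (h j hj hij hjg) hs (ht.getElem j hj).choose_spec
    have ihge := fun j hj hj' hji hjf => ge_inst hφ hL (hge j hj hj' hji hjf)
    have ihgt := gt_inst hφ hL hgt
    rw [inst_apps γ ht]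
    rw [inst_fn_apps_of_not_isTheory γ hs hth] at ih ⊢
    refine rpo_contract (fun j hj => hf j (by simpa using hj)) fun _ => ?_
    refine inst_rpo_lex (fun j hj => hf j (by simpa using hj)) hfg i (by simpa using hi) (by simpa using hi') hif hig
      hiff (fun j hj hj' hji hjf => ?_) (by simpa using ihgt) fun j hj hij hjg => ?_
    · simpa using ihge j (by simpa using hj) (by simpa using hj') hji hjf
    · simpa using ih j (by simpa using hj) hij hjg
  | _, _, .th f ss t i hth hf ht hti hvars => fun hs _ => by
    -- The variables in `L` become ground theory terms, so the instance of `t` normalises to a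
    -- value, which lies below `f`.
    obtain ⟨_, j, hj, a, e⟩ := isTheoryNormal_knf
      (PTerm.IsGroundTheory.subst ht fun x hx => hL x (hvars hx)) (hti.subst γ)
    rw [inst_fn_apps_of_not_isTheory γ hs hth, show inst γ t = _ from e]
    exact D.rpo_val (fun j hj => hf j (by simpa using hj)) j hj a

end

-- Assembly of the constrained reduction pair

variable (D)

theorem isCoveringPair : IsCoveringPair D.ge D.gt D.cge D.cgt where
  refl s := by
    obtain ⟨a, ha⟩ := s.2
    exact .approx (.refl D.isPrecedence.refl ha.hasShape)
  wf := by
    refine ⟨fun s => ?_⟩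
    obtain ⟨a, ha⟩ := s.2
    exact InvImage.accessible Subtype.val
      ((ha.hasShape.computable D.isPrecedence).terminates D.isPrecedence)
  covers_ge _ _ _ _ h _ hφ hL := ge_inst hφ hL h
  covers_gt _ _ _ _ h _ hφ hL := gt_inst hφ hL h
  kappa s t h := by
    obtain ⟨a, ha⟩ := s.2
    exact D.ge_of_kStep h ha.hasShape
  compat := by
    -- A step of `≈` is absorbed by the following `⊐`; two `⊐`-steps are kept as a chain, so
    -- transitivity of `⊐` is not required.
    refine .inl fun s t r hst htr => ?_
    rcases hst with h | h
    · exact .single (h.trans_gt D.isPrecedence htr)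
    · exact .tail (.single h) htr
  mono s t hst C hs ht := by
    suffices ∀ {a b}, HasShape (C.plug s.1) a → HasShape (C.plug t.1) b →
        Ge D.precExt D.filterExt (C.plug s.1) (C.plug t.1) from
      this hs.choose_spec.hasShape ht.choose_spec.hasShape
    clear hs ht
    induction C with
    | hole => exact fun _ _ => hst
    | left C r ih =>
      intro a b hs ht
      obtain ⟨_, h1, h2⟩ := hs.app_inv
      obtain ⟨_, h3, _⟩ := ht.app_inv
      exact (ih h1 h3).app (.approx (.refl D.isPrecedence.refl h2)) hs
    | right r C ih =>
      intro a b hs ht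
      obtain ⟨_, h1, h2⟩ := hs.app_inv
      obtain ⟨_, _, h3⟩ := ht.app_inv
      exact Ge.app (.approx (.refl D.isPrecedence.refl h1)) (ih h2 h3) hs

end Ingredients

theorem IsCoveringPair.onSameType {ge gt : Term S → Term S → Prop} {cge cgt : CRel S}
    (h : IsCoveringPair ge gt cge cgt) :
    IsConstrainedReductionPair cge.onSameType cgt.onSameType :=
  ⟨fun _ _ _ _ h => h.1, fun _ _ _ _ h => h.1, ge, gt,
    { h with
      covers_ge := fun s t φ L k => h.covers_ge s t φ L k.2
      covers_gt := fun s t φ L k => h.covers_gt s t φ L k.2 }⟩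

end LCSTRS

theorem mainTheorem1 (S : LCSTRS.Signature.{u, v, w}) (D : LCSTRS.Ingredients S) :
    LCSTRS.IsCoveringPair D.ge D.gt D.cge D.cgt ∧
      LCSTRS.IsConstrainedReductionPair D.cge.onSameType D.cgt.onSameType :=
  ⟨D.isCoveringPair, D.isCoveringPair.onSameType⟩
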